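/- A *scalable group* is a topological group $G$ (with identity $e_G$) with a continuous map $\delta:\mathbb R\times G\to G$ such that $\delta_t\in\mathrm{Aut}(G)$ for $t\neq 0$, $\delta_s\circ\delta_t=\delta_{st}$ for all $s,t\in\mathbb R$, and $\delta_0\equiv e_G$. It is a *metric scalable group* if its topology is induced by a left-invariant distance $d$ with $d(\delta_t p,\delta_t q)=|t|\,d(p,q)$ for all $t\in\mathbb R$ and $p,q\in G$. A subgroup $H$ is *scalable* if $\delta_t(H)=H$ for all $t\ne0$; it is then a scalable group with the subspace topology. The *first layer* $V_1(G)$ is the set of $p\in G$ with $\delta_{s+t}(p)=\delta_s(p)\delta_t(p)$ for all $s,t\in\mathbb R$. A set $B$ *generates* a scalable group $H$ if $H$ is the closure (in $H$) of the group generated by $\{\delta_t(b): b\in B,\ t\in\mathbb R\}$. A *Carnot group* is a simply connected (finite-dimensional, real) Lie group $N$ whose Lie algebra is equipped with a stratification $\mathfrak n=V_1\oplus\dots\oplus V_s$, $[V_1,V_k]=V_{k+1}$ for $1\le k\le s$, where $V_{s+1}=0$; its dilation of factor $t$ is the smooth homomorphism $N\to N$ whose differential at the identity is multiplication by $t^k$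 on $V_k$ for every $k$. A scalable group *has a Carnot structure* if it is isomorphic, as a topological group and by an isomorphism carrying dilations to dilations, to a Carnot group. For $a\in V_1(G)$ let $\mathcal U(a)$ be the class of Borel sets $A\subseteq G$ such that for every $g\in G$ the set $\{t\in\mathbb R: g\,\delta_t(a)\in A\}$ has Lebesgue measure zero; for $a_1,\dots,a_m\in V_1(G)$ let $\mathcal U(\{a_1,\dots,a_m\})$ be the class of Borel sets of the form $A=A_1\cup\dots\cup A_m$ with $A_i\in\mathcal U(a_i)$ for each $i$. **Proposition.** Let $G$ be a metric scalable group, let $H$ be a scalable subgroup of $G$ that has a Carnot structure and is generated, as a scalable group, by elements $a_1,\dots,a_m\in V_1(G)\cap H$, let $\operatorname{vol}_H$ be any Haar measure on $H$, and let $A\subseteq G$ be a Borel set. Then $$\operatorname{vol}_H(H\cap gA)=0\quad\text{for all } g\in G\qquad\Longleftrightarrow\qquad A\in\mathcal U(\{a_1,\dots,a_m\}).$$ -/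

import Mathlib

open scoped Manifold ContDiff Pointwise
open MeasureTheory

universe u

/-- The structure of a scalable group on a topological group `G`: a continuous family of dilations
`δ : ℝ × G → G` with `δ_t ∈ Aut(G)` for `t ≠ 0`, `δ_s ∘ δ_t = δ_{st}` and `δ_0 ≡ e`. -/
structure ScalableStructure (G : Type u) [Group G] [TopologicalSpace G] where
  /-- The dilation `δ_t x`. -/
  dil : ℝ → G → G
  continuous_dil : Continuous (fun p : ℝ × G => dil p.1 p.2)
  map_mul : ∀ t : ℝ, t ≠ 0 → ∀ x y : G, dil t (x * y) = dil t x * dil t y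
  bijective : ∀ t : ℝ, t ≠ 0 → Function.Bijective (dil t)
  dil_dil : ∀ (s t : ℝ) (x : G), dil s (dil t x) = dil (s * t) x
  dil_zero : ∀ x : G, dil 0 x = 1

namespace ScalableStructure

section Topological

variable {G : Type u} [Group G] [TopologicalSpace G]

/-- `H` is a scalable subgroup: `δ_t(H) = H` for all `t ≠ 0`. -/
def IsScalableSubgroup (S : ScalableStructure G) (H : Subgroup G) : Prop :=
  ∀ t : ℝ, t ≠ 0 → S.dil t '' (H : Set G) = H

/-- A scalable subgroup is stable under every dilation, including `δ_0`. -/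
theorem IsScalableSubgroup.dil_mem {S : ScalableStructure G} {H : Subgroup G}
    (hH : S.IsScalableSubgroup H) (t : ℝ) {x : G} (hx : x ∈ H) : S.dil t x ∈ H := by
  by_cases ht : t = 0
  · subst ht
    rw [S.dil_zero]
    exact H.one_mem
  · have h : S.dil t x ∈ S.dil t '' (H : Set G) := Set.mem_image_of_mem _ hx
    rw [hH t ht] at h
    exact h

/-- The scalable structure that a scalable subgroup inherits, on the subspace topology. -/
def restrict (S : ScalableStructure G) (H : Subgroup G) (hH : S.IsScalableSubgroup H) :
    ScalableStructure H where
  dil t x := ⟨S.dil t x, hH.dil_mem t x.2⟩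
  continuous_dil := by
    refine Continuous.subtype_mk ?_ _
    exact S.continuous_dil.comp (continuous_fst.prodMk (continuous_subtype_val.comp continuous_snd))
  map_mul t ht x y := Subtype.ext (S.map_mul t ht x y)
  bijective t ht := by
    refine ⟨fun x y hxy => Subtype.ext ((S.bijective t ht).1 (congrArg Subtype.val hxy)), ?_⟩
    rintro ⟨y, hy⟩
    have hy' : y ∈ S.dil t '' (H : Set G) := by
      rw [hH t ht]
      exact hy
    obtain ⟨x, hx, rfl⟩ := hy'
    exact ⟨⟨x, hx⟩, rfl⟩
  dil_dil s t x := Subtype.ext (S.dil_dil s t x)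
  dil_zero x := Subtype.ext (S.dil_zero x)

/-- The first layer `V₁(G)`: the points `p` such that `t ↦ δ_t p` is a one-parameter subgroup. -/
def firstLayer (S : ScalableStructure G) : Set G :=
  {p | ∀ s t : ℝ, S.dil (s + t) p = S.dil s p * S.dil t p}

/-- `B` generates `G` as a scalable group: `G` is the closure of the group generated by
`{δ_t b : b ∈ B, t ∈ ℝ}`. -/
def Generates (S : ScalableStructure G) (B : Set G) : Prop :=
  closure (Subgroup.closure {x : G | ∃ b ∈ B, ∃ t : ℝ, x = S.dil t b} : Set G) = Set.univ

end Topological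

end ScalableStructure

section Carnot

/-- A stratification `𝔤 = V₁ ⊕ ⋯ ⊕ V_s`, `[V₁, V_k] = V_{k+1}` for `k ≥ 1`, `V_k = 0` for `k > s`, of
the Lie algebra `𝔤` of a Lie group `N`. The layers are indexed by `ℕ`, with a zero layer of
index `0`. -/
structure IsStratification (n : ℕ) (N : Type u) [Group N] [TopologicalSpace N]
    [ChartedSpace (EuclideanSpace ℝ (Fin n)) N]
    (V : ℕ → Submodule ℝ (GroupLieAlgebra (𝓡 n) N)) : Prop where
  zero : V 0 = ⊥
  isInternal : DirectSum.IsInternal V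
  bracket : ∀ k : ℕ, 1 ≤ k →
    Submodule.span ℝ {z : GroupLieAlgebra (𝓡 n) N | ∃ x ∈ V 1, ∃ y ∈ V k, z = ⁅x, y⁆} = V (k + 1)
  finite : ∃ s : ℕ, ∀ k : ℕ, s < k → V k = ⊥

/-- `ζ` is the dilation of factor `t` of the Lie group `N` with respect to the layers `V`: the smooth
endomorphism of `N` whose differential at the identity is multiplication by `t ^ k` on `V k`.
(It fixes the identity, so both tangent spaces below are the Lie algebra of `N`.) -/
def IsStratifiedDilation (n : ℕ) (N : Type u) [Group N] [TopologicalSpace N]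
    [ChartedSpace (EuclideanSpace ℝ (Fin n)) N]
    (V : ℕ → Submodule ℝ (GroupLieAlgebra (𝓡 n) N)) (t : ℝ) (ζ : N →* N) : Prop :=
  ContMDiff (𝓡 n) (𝓡 n) ∞ ζ ∧
    ∀ k : ℕ, ∀ X ∈ V k,
      (mfderiv (𝓡 n) (𝓡 n) ζ 1 X : EuclideanSpace ℝ (Fin n)) = t ^ k • X

/-- The scalable group `(G, δ)` has a Carnot group structure: there is a Carnot group `N`, i.e. a
simply connected real Lie group with a stratification of its Lie algebra, and an isomorphism of
topological groups `e : N → G` that carries the dilations of `N` to those of `G`. -/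
def ScalableStructure.HasCarnotStructure {G : Type u} [Group G] [TopologicalSpace G]
    (S : ScalableStructure G) : Prop :=
  ∃ (n : ℕ) (N : Type u) (_ : Group N) (_ : TopologicalSpace N)
    (_ : ChartedSpace (EuclideanSpace ℝ (Fin n)) N) (_ : LieGroup (𝓡 n) ∞ N)
    (_ : SimplyConnectedSpace N) (V : ℕ → Submodule ℝ (GroupLieAlgebra (𝓡 n) N))
    (ζ : ℝ → N →* N) (e : N ≃ₜ* G),
    IsStratification n N V ∧
    (∀ t : ℝ, IsStratifiedDilation n N V t (ζ t)) ∧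
    ∀ (t : ℝ) (x : N), e (ζ t x) = S.dil t (e x)

end Carnot

/-- The structure of a metric scalable group on a metric group `G`: dilations for the metric
topology, for which the distance is left-invariant and homogeneous. -/
structure MetricScalableStructure (G : Type u) [Group G] [MetricSpace G] extends
    ScalableStructure G where
  dist_mul_left : ∀ g p q : G, dist (g * p) (g * q) = dist p q
  dist_dil : ∀ (t : ℝ) (p q : G), dist (dil t p) (dil t q) = |t| * dist p q

namespace ScalableStructure

variable {G : Type u} [Group G] [TopologicalSpace G] [MeasurableSpace G]

/-- The class `𝒰(a)`: the measurable sets that are null on every left-translated line `g·ℝa`, the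
measure of `A ∩ g·ℝa` being the Lebesgue measure of `{t : g δ_t(a) ∈ A}`. -/
def nullAlong (S : ScalableStructure G) (a : G) : Set (Set G) :=
  {A | MeasurableSet A ∧ ∀ g : G, volume {t : ℝ | g * S.dil t a ∈ A} = 0}

/-- The exceptional class `𝒰({a_i})`: the measurable sets `A = ⋃ A_i` with `A_i ∈ 𝒰(a_i)`. -/
def exceptionalClass (S : ScalableStructure G) {ι : Type*} (a : ι → G) : Set (Set G) :=
  {A | MeasurableSet A ∧ ∃ B : ι → Set G, A = ⋃ i, B i ∧ ∀ i, B i ∈ S.nullAlong (a i)}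

end ScalableStructure

/-! From right to left the theorem is Fubini on H × ℝ: if B is null on every translate of the line t
↦ δ_t(a), then for almost every t a right translate of B by a point of that line is Haar-null, and
right translations preserve the null sets of a left Haar measure (`haar_eq_zero_of_volume_line`).

For the converse it suffices to find one word w such that the map sending t in ℝ^K to the product of
the δ_{t_i}(a_{w i}) pulls Haar-null sets of H back to Lebesgue-null sets. Then A is null along
every left translate of this map, and Fubini peels off the letters one by one. If D is the set of
points whose line in the direction of the rightmost letter meets A in positive measure, then A \ D
is null along that letter and A ∩ D is null along the shorter word
(`mem_exceptionalClass_of_volume_wordProduct`).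

Such a word exists because the product map can be made a submersion. Let X_i be the velocity at 0 of
γ_i(s) = δ_s(a_i), read in the Carnot group N, and translate the differential of a word product back
to the identity. Appending a letter to a word of maximal rank replaces the range by its image under
some Ad(γ_i(s))⁻¹, and the new range contains X_i. Hence the intersection of all ranges of maximal
dimension contains every X_i and is stable under Ad(γ_i(s)), so under ad X_i. As the X_i span V_1
and V_1 generates the Lie algebra, this intersection is everything (`exists_surjective_wordDeriv`,
`eq_top_of_stratification`). So the product is a submersion at some point. Since Ad(γ_i(s)) = exp(s
ad X_i), a suitable determinant is real analytic in t, and the product is a submersion almost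
everywhere.

That the X_i span V_1 must be extracted from topological generation. A continuous homomorphism χ
from N to its Lie algebra, tangent at the identity to the projection onto V_1, sends the dense
subgroup generated by the lines, hence all of N, into the span of the X_i; differentiating χ at the
identity gives V_1 (`mem_span_of_mem_firstLayer`). Both χ and the differentiability of continuous
one-parameter subgroups come from the same limit of rescaled almost homomorphisms
(`exists_hom_of_quadratic_error`). The exponential map of N is never used. -/

/-! ### Products along words, and Fubini on ℝ^(K+1) -/

/-- The product `γ_{w (K-1)} (t (K-1)) * ⋯ * γ_{w 0} (t 0)` along a word `w`. -/
def wordProduct {ι G : Type*} [Group G] (γ : ι → ℝ → G) :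
    (K : ℕ) → (Fin K → ι) → (Fin K → ℝ) → G
  | 0, _, _ => 1
  | K + 1, w, t => wordProduct γ K (Fin.tail w) (Fin.tail t) * γ (w 0) (t 0)

theorem continuous_wordProduct {ι G : Type*} [Group G] [TopologicalSpace G] [ContinuousMul G]
    {γ : ι → ℝ → G} (hγ : ∀ i, Continuous (γ i)) :
    ∀ (K : ℕ) (w : Fin K → ι), Continuous (wordProduct γ K w)
  | 0, _ => continuous_const
  | K + 1, w => by
    have h := continuous_wordProduct hγ K (Fin.tail w)
    exact (h.comp (continuous_pi fun i => continuous_apply i.succ)).mul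
      ((hγ (w 0)).comp (continuous_apply 0))

theorem map_wordProduct {ι G G' : Type*} [Group G] [Group G'] (f : G →* G') (γ : ι → ℝ → G) :
    ∀ (K : ℕ) (w : Fin K → ι) (t : Fin K → ℝ),
      f (wordProduct γ K w t) = wordProduct (fun i s => f (γ i s)) K w t
  | 0, _, _ => f.map_one
  | K + 1, w, t => by
    rw [wordProduct, f.map_mul, map_wordProduct f γ K, wordProduct]

/-- Fubini for null sets of `ℝ ^ (K + 1)`, the coordinate of index `0` being split off. -/
theorem volume_fin_succ_eq_zero_iff {K : ℕ} {s : Set (Fin (K + 1) → ℝ)} (hs : MeasurableSet s) :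
    volume s = 0 ↔
      ∀ᵐ t : Fin K → ℝ, volume {r : ℝ | (Fin.cons r t : Fin (K + 1) → ℝ) ∈ s} = 0 := by
  have h := (volume_preserving_piFinSuccAbove (fun _ : Fin (K + 1) => ℝ) 0).symm
  rw [← h.measure_preimage hs.nullMeasurableSet, Measure.volume_eq_prod, ← Measure.prod_swap,
    Measure.map_apply measurable_swap (h.measurable hs),
    Measure.measure_prod_null (measurable_swap (h.measurable hs))]
  refine Filter.eventually_congr (Filter.Eventually.of_forall fun t => ?_)
  have e : Prod.mk t ⁻¹' (Prod.swap ⁻¹'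
      ((MeasurableEquiv.piFinSuccAbove (fun _ : Fin (K + 1) => ℝ) 0).symm ⁻¹' s)) =
      {r : ℝ | (Fin.cons r t : Fin (K + 1) → ℝ) ∈ s} := by
    ext r
    simp [MeasurableEquiv.piFinSuccAbove, Fin.insertNthEquiv]
  exact iff_of_eq (congrArg (fun s => volume s = 0) e)

/-! ### Null sets along lines, exceptional sets and Haar measure -/

namespace ScalableStructure

theorem continuous_dil_left {G : Type u} [Group G] [TopologicalSpace G]
    (S : ScalableStructure G) (a : G) : Continuous fun t => S.dil t a :=
  S.continuous_dil.comp (continuous_id.prodMk continuous_const)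

section Word

variable {G : Type u} [Group G] [TopologicalSpace G] [MeasurableSpace G]

theorem empty_mem_nullAlong (S : ScalableStructure G) (a : G) : ∅ ∈ S.nullAlong a :=
  ⟨MeasurableSet.empty, fun g => by simp⟩

theorem union_mem_nullAlong (S : ScalableStructure G) {a : G} {A B : Set G}
    (hA : A ∈ S.nullAlong a) (hB : B ∈ S.nullAlong a) : A ∪ B ∈ S.nullAlong a :=
  ⟨hA.1.union hB.1, fun g => measure_union_null (hA.2 g) (hB.2 g)⟩

theorem measurableSet_volume_line_ne_zero [ContinuousMul G] [BorelSpace G]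
    (S : ScalableStructure G) (a : G) {A : Set G} (hA : MeasurableSet A) :
    MeasurableSet {g : G | volume {t : ℝ | g * S.dil t a ∈ A} ≠ 0} := by
  have hc : Continuous fun p : G × ℝ => p.1 * S.dil p.2 a :=
    continuous_fst.mul ((S.continuous_dil_left a).comp continuous_snd)
  exact (measurable_measure_prodMk_left (ν := (volume : Measure ℝ))
    (hc.measurable hA)) (measurableSet_singleton 0).compl

/-- The points of `A` whose `a`-line meets `A` in a set of measure zero are null along `a`. -/
theorem diff_volume_line_mem_nullAlong [ContinuousMul G] [BorelSpace G]
    (S : ScalableStructure G) {a : G} (ha : a ∈ S.firstLayer) {A : Set G} (hA : MeasurableSet A) :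
    A \ {g : G | volume {t : ℝ | g * S.dil t a ∈ A} ≠ 0} ∈ S.nullAlong a := by
  refine ⟨hA.diff (S.measurableSet_volume_line_ne_zero a hA), fun g => ?_⟩
  by_cases h : volume {t : ℝ | g * S.dil t a ∈ A} = 0
  · exact measure_mono_null (fun t ht => ht.1) h
  · convert measure_empty (μ := (volume : Measure ℝ))
    refine Set.eq_empty_of_forall_notMem fun t ht => ht.2 ?_
    -- By the first-layer law every point of the line of g carries the same line, shifted in its
    -- parameter. If that line meets A in positive measure, all its points have been removed.
    have e : {s : ℝ | g * S.dil t a * S.dil s a ∈ A} =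
        (fun s => t + s) ⁻¹' {s : ℝ | g * S.dil s a ∈ A} := by
      ext s
      simp only [Set.mem_ofPred_eq, Set.mem_preimage, ha t s, mul_assoc]
    rw [Set.mem_ofPred_eq, e, measure_preimage_add]
    exact h

/-- A set whose translates are null along the products of a word is exceptional. -/
theorem mem_exceptionalClass_of_volume_wordProduct [ContinuousMul G] [BorelSpace G]
    {ι : Type*} (S : ScalableStructure G) {a : ι → G} (ha : ∀ i, a i ∈ S.firstLayer) :
    ∀ (K : ℕ) (w : Fin K → ι) (A : Set G), MeasurableSet A →
      (∀ g : G, volume {t | g * wordProduct (fun i s => S.dil s (a i)) K w t ∈ A} = 0) →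
      A ∈ S.exceptionalClass a
  | 0, w, A, hA, h => by
    refine ⟨hA, fun _ => ∅, ?_, fun i => S.empty_mem_nullAlong _⟩
    rw [Set.iUnion_empty]
    refine Set.eq_empty_of_forall_notMem fun g hg => ?_
    -- ℝ^0 is one point of positive volume, so nullity along the empty word forces A to be empty.
    have e : {t | g * wordProduct (fun i s => S.dil s (a i)) 0 w t ∈ A} = Set.univ :=
      Set.eq_univ_of_forall fun t => by simpa [wordProduct] using hg
    have h' := h g
    rw [e] at h'
    exact isOpen_univ.measure_ne_zero volume Set.univ_nonempty h'
  | K + 1, w, A, hA, h => by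
    classical
    set D := {g : G | volume {t : ℝ | g * S.dil t (a (w 0)) ∈ A} ≠ 0} with hD
    have hDm : MeasurableSet D := S.measurableSet_volume_line_ne_zero _ hA
    have hc : ∀ (K : ℕ) (w : Fin K → ι),
        Continuous (wordProduct (fun i s => S.dil s (a i)) K w) :=
      continuous_wordProduct fun i => S.continuous_dil_left (a i)
    -- The letter `w 0` is the rightmost factor, so fixing the other parameters cuts out an `a (w
    -- 0)`-line. By Fubini almost all of these lines meet A in measure zero; hence the shorter
    -- product almost never lands in D.
    obtain ⟨-, B, hB, hBn⟩ := mem_exceptionalClass_of_volume_wordProduct S ha K (Fin.tail w)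
      (A ∩ D) (hA.inter hDm) fun g => by
        have h' := (volume_fin_succ_eq_zero_iff
          ((continuous_const.mul (hc (K + 1) w)).measurable hA)).1 (h g)
        refine measure_mono_null (fun t ht => ?_) h'
        obtain ⟨-, ht⟩ := ht
        rw [hD, Set.mem_ofPred_eq] at ht
        simpa [wordProduct, mul_assoc] using ht
    refine ⟨hA, fun i => if i = w 0 then B i ∪ A \ D else B i, ?_, fun i => ?_⟩
    · refine (Set.inter_union_sdiff A D).symm.trans ?_
      rw [hB]
      ext x
      simp only [Set.mem_union, Set.mem_iUnion]
      constructor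
      · rintro (⟨i, hi⟩ | hx)
        · refine ⟨i, ?_⟩
          split_ifs
          · exact Or.inl hi
          · exact hi
        · exact ⟨w 0, by rw [if_pos rfl]; exact Or.inr hx⟩
      · rintro ⟨i, hi⟩
        split_ifs at hi with hw
        · rcases hi with hi | hi
          · exact Or.inl ⟨i, hi⟩
          · exact Or.inr hi
        · exact Or.inl ⟨i, hi⟩
    · dsimp only
      split_ifs with hi
      · subst hi
        exact S.union_mem_nullAlong (hBn _) (S.diff_volume_line_mem_nullAlong (ha _) hA)
      · exact hBn i

end Word

/-- A locally compact scalable group is σ-compact. -/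
theorem sigmaCompactSpace {G : Type u} [Group G] [TopologicalSpace G] [LocallyCompactSpace G]
    (S : ScalableStructure G) : SigmaCompactSpace G := by
  obtain ⟨C, hC, hC1⟩ := exists_compact_mem_nhds (1 : G)
  refine ⟨⟨fun n : ℕ => S.dil n '' C, fun n => hC.image
    (S.continuous_dil.comp (continuous_const.prodMk continuous_id)), ?_⟩⟩
  refine Set.eq_univ_of_forall fun x => ?_
  have h1 : Filter.Tendsto (fun n : ℕ => S.dil ((n : ℝ)⁻¹) x) Filter.atTop (nhds 1) := by
    have := ((S.continuous_dil_left x).tendsto 0).comp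
      (tendsto_inv_atTop_zero.comp (tendsto_natCast_atTop_atTop (R := ℝ)))
    rwa [S.dil_zero] at this
  obtain ⟨n, hn, hn0⟩ := ((h1.eventually hC1).and (Filter.eventually_ne_atTop 0)).exists
  refine Set.mem_iUnion.2 ⟨n, _, hn, ?_⟩
  rw [S.dil_dil, mul_inv_cancel₀ (Nat.cast_ne_zero.2 hn0)]
  -- δ_1 is idempotent and injective, hence the identity.
  have h2 : S.dil 1 (S.dil 1 x) = S.dil 1 x := by rw [S.dil_dil, one_mul]
  exact (S.bijective 1 one_ne_zero).1 h2

/-- A measurable set which is null on all the lines of direction `a` is Haar-null. -/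
theorem haar_eq_zero_of_volume_line {H : Type u} [Group H] [TopologicalSpace H]
    [IsTopologicalGroup H] [SecondCountableTopology H] [MeasurableSpace H] [BorelSpace H]
    (S : ScalableStructure H) (a : H) (μ : Measure H) [SFinite μ] [μ.IsMulLeftInvariant]
    {A : Set H} (hA : MeasurableSet A) (h : ∀ g : H, volume {t : ℝ | g * S.dil t a ∈ A} = 0) :
    μ A = 0 := by
  have hc : Continuous fun p : H × ℝ => p.1 * S.dil p.2 a :=
    continuous_fst.mul ((S.continuous_dil_left a).comp continuous_snd)
  have h0 : (μ.prod volume) ((fun p : H × ℝ => p.1 * S.dil p.2 a) ⁻¹' A) = 0 :=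
    (Measure.measure_prod_null (hc.measurable hA)).2 (Filter.Eventually.of_forall h)
  rw [← Measure.prod_swap, Measure.map_apply measurable_swap (hc.measurable hA),
    Measure.measure_prod_null (measurable_swap (hc.measurable hA))] at h0
  -- A single good t is enough: a left Haar measure need not be right invariant, but its null sets
  -- are.
  obtain ⟨t, ht⟩ := h0.exists
  exact (measure_mul_right_null μ (S.dil t a)).1 ht

end ScalableStructure

/-! ### Zeros of analytic functions, and null sets under submersions -/

open Filter Topology in
/-- A real analytic function on `ℝ ^ K` which does not vanish identically is a.e. nonzero. -/
theorem ae_ne_zero_of_analyticOnNhd : ∀ (K : ℕ) (f : (Fin K → ℝ) → ℝ),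
    AnalyticOnNhd ℝ f Set.univ → ∀ x, f x ≠ 0 → ∀ᵐ t, f t ≠ 0
  | 0, f, _, x, hx => Filter.Eventually.of_forall fun t => by rwa [Subsingleton.elim t x]
  | K + 1, f, hf, x, hx => by
    have hcons : ∀ p : ℝ × (Fin K → ℝ), AnalyticAt ℝ
        (fun p : ℝ × (Fin K → ℝ) => (Fin.cons p.1 p.2 : Fin (K + 1) → ℝ)) p := fun p => by
      refine AnalyticAt.pi fun i => ?_
      refine Fin.cases ?_ (fun j => ?_) i
      · exact analyticAt_fst
      · exact ((ContinuousLinearMap.proj (R := ℝ) (φ := fun _ : Fin K => ℝ) j).analyticAt _).comp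
          analyticAt_snd
    have hm : MeasurableSet {t | f t = 0} :=
      (isClosed_eq (continuousOn_univ.1 hf.continuousOn) continuous_const).measurableSet
    -- Freezing coordinate 0 at `x 0` keeps the nonzero value at x. For almost every t the
    -- one-variable slice r ↦ f(r, t) is then nonzero at `x 0`, so its zeros are isolated.
    have h1 : ∀ᵐ t : Fin K → ℝ, f (Fin.cons (x 0) t) ≠ 0 := by
      refine ae_ne_zero_of_analyticOnNhd K _ (fun t _ => ?_) (Fin.tail x) ?_
      · exact (hf _ trivial).comp_of_eq
          ((hcons (x 0, t)).comp (analyticAt_const.prod analyticAt_id)) rfl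
      · rwa [Fin.cons_self_tail]
    have h5 : volume {t | f t = 0} = 0 := by
      refine (volume_fin_succ_eq_zero_iff hm).2 (h1.mono fun t ht => ?_)
      have h2 : AnalyticOnNhd ℝ (fun r : ℝ => f (Fin.cons r t)) Set.univ := fun r _ =>
        (hf _ trivial).comp_of_eq (AnalyticAt.comp (f := fun r : ℝ => (r, t)) (hcons (r, t))
          (analyticAt_id.prod analyticAt_const)) rfl
      have h3 := h2.preimage_zero_mem_codiscrete ht
      have h4 := ae_restrict_le_codiscreteWithin (μ := (volume : Measure ℝ)) MeasurableSet.univ h3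
      rw [Measure.restrict_univ, mem_ae_iff] at h4
      refine measure_mono_null (fun r hr => ?_) h4
      exact fun h => h hr
    rw [ae_iff]
    simpa using h5

open Filter Topology in
/-- Null sets pull back to null sets near a point where the derivative is strict and onto. -/
theorem HasStrictFDerivAt.exists_measure_inter_preimage_eq_zero {V E : Type*}
    [NormedAddCommGroup V] [NormedSpace ℝ V] [FiniteDimensional ℝ V] [MeasurableSpace V]
    [BorelSpace V] [NormedAddCommGroup E] [NormedSpace ℝ E] [FiniteDimensional ℝ E]
    [MeasurableSpace E] [BorelSpace E] (μ : Measure V) [μ.IsAddHaarMeasure] (ν : Measure E)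
    [ν.IsAddHaarMeasure] {F : V → E} {L : V →L[ℝ] E} {x : V} (hF : HasStrictFDerivAt F L x)
    (hL : Function.Surjective L) {s : Set E} (hs : ν s = 0) :
    ∃ U ∈ 𝓝 x, μ (U ∩ F ⁻¹' s) = 0 := by
  obtain ⟨R, hR⟩ := (L : V →ₗ[ℝ] E).exists_rightInverse_of_surjective (LinearMap.range_eq_top.2 hL)
  have hR' : ∀ y, L (R y) = y := fun y => LinearMap.congr_fun hR y
  set R' : E →L[ℝ] V := LinearMap.toContinuousLinearMap R
  have hR'' : ∀ y, L (R' y) = y := hR'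
  -- Ψ straightens F: L ∘ Ψ = F and the derivative of Ψ at x is the identity. Thus Ψ maps F⁻¹(s)
  -- into the null set L⁻¹(s), while near x it shrinks measure by at most a fixed factor; the 1/2
  -- below is any constant in (0, 1).
  set Ψ : V → V := fun t => R' (F t) + (t - R' (L t))
  have hΨ : HasStrictFDerivAt Ψ (ContinuousLinearMap.id ℝ V) x := by
    have h := (R'.hasStrictFDerivAt.comp x hF).add ((hasStrictFDerivAt_id x).sub
      ((R'.comp L).hasStrictFDerivAt))
    have e : R'.comp L + (ContinuousLinearMap.id ℝ V - R'.comp L) = ContinuousLinearMap.id ℝ V :=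
      add_sub_cancel _ _
    rw [e] at h
    exact h
  have hdet : ((1 / 2 : NNReal) : ENNReal) <
      ENNReal.ofReal |(ContinuousLinearMap.id ℝ V).det| := by
    have : (ContinuousLinearMap.id ℝ V).det = 1 := LinearMap.det_id
    rw [this]
    simp
  obtain ⟨δ, hδ, hδ0⟩ := ((mul_le_addHaar_image_of_lt_det μ (ContinuousLinearMap.id ℝ V)
    hdet).and self_mem_nhdsWithin).exists
  obtain ⟨U, hU, hUδ⟩ := hΨ.approximates_deriv_on_nhds (c := δ) (Or.inr hδ0)
  refine ⟨U, hU, ?_⟩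
  have h1 := hδ (U ∩ F ⁻¹' s) Ψ (hUδ.mono_set Set.inter_subset_left)
  have h2 : μ (Ψ '' (U ∩ F ⁻¹' s)) = 0 := by
    have hnull : ∀ᵐ v ∂μ, (L : V →ₗ[ℝ] E) v ∈ (toMeasurable ν s)ᶜ := by
      refine (ae_comp_linearMap_mem_iff (L := (L : V →ₗ[ℝ] E)) μ ν hL
        (measurableSet_toMeasurable ν s).compl).2 ?_
      rw [ae_iff]
      simpa using hs
    refine measure_mono_null ?_ hnull
    rintro _ ⟨t, ⟨-, ht⟩, rfl⟩
    have e : L (Ψ t) = F t := by simp [Ψ, hR'']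
    simp only [Set.mem_compl_iff, Set.mem_ofPred_eq, not_not, ContinuousLinearMap.coe_coe, e]
    exact subset_toMeasurable ν s ht
  rw [h2, nonpos_iff_eq_zero, mul_eq_zero] at h1
  exact h1.resolve_left (by simp)

/-! ### One-parameter semigroups in a Banach algebra -/

section OneParameter

variable {𝔸 : Type*} [NormedRing 𝔸] [NormedAlgebra ℝ 𝔸] [CompleteSpace 𝔸]

/-- A one-parameter semigroup differentiable at `0` is an exponential. -/
theorem eq_exp_of_hasDerivAt_zero {A : ℝ → 𝔸} {B : 𝔸} (h0 : A 0 = 1)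
    (hA : ∀ s t, A (s + t) = A s * A t) (hB : HasDerivAt A B 0) (s : ℝ) :
    A s = NormedSpace.exp (s • B) := by
  have h1 : ∀ s, HasDerivAt A (A s * B) s := fun s => by
    have h : HasDerivAt (fun t => A s * A (t - s)) (A s * B) s := by
      refine HasDerivAt.const_mul _ ?_
      have hB' : HasDerivAt A B (s - s) := by rwa [sub_self]
      exact hB'.comp_sub_const s s
    convert h using 2 with t
    rw [← hA, add_sub_cancel]
  -- Since A' = A B, the product A(t) exp(-tB) is constant.
  have h2 : ∀ s, HasDerivAt (fun t => A t * NormedSpace.exp ((-t) • B)) 0 s := fun s => by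
    have h := (hasDerivAt_exp_smul_const' (𝕂 := ℝ) B (-s)).scomp s (hasDerivAt_neg s)
    have h3 := (h1 s).mul h
    have e : A s * B * NormedSpace.exp ((-s) • B) +
        A s * (-1 : ℝ) • (B * NormedSpace.exp ((-s) • B)) = 0 := by
      rw [neg_one_smul, mul_neg, mul_assoc, add_neg_cancel]
    exact e ▸ h3
  have h3 := is_const_of_deriv_eq_zero (fun s => (h2 s).differentiableAt)
    (fun s => (h2 s).deriv) s 0
  simp only [h0, neg_zero, zero_smul, NormedSpace.exp_zero, mul_one] at h3
  have h4 : NormedSpace.exp ((-s) • B) * NormedSpace.exp (s • B) = 1 := by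
    rw [← NormedSpace.exp_add_of_commute_of_mem_ball (𝕂 := ℝ)]
    · simp
    · exact (Commute.refl B).smul_left _ |>.smul_right _
    · rw [NormedSpace.expSeries_radius_eq_top]; exact edist_lt_top _ _
    · rw [NormedSpace.expSeries_radius_eq_top]; exact edist_lt_top _ _
  calc A s = A s * (NormedSpace.exp ((-s) • B) * NormedSpace.exp (s • B)) := by rw [h4, mul_one]
    _ = _ := by rw [← mul_assoc, h3, one_mul]

end OneParameter

/-! ### From almost homomorphisms to homomorphisms -/

section AlmostHom

open Filter Topology

variable {Γ F : Type*} [Group Γ] [TopologicalSpace Γ] [IsTopologicalGroup Γ]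
  [NormedAddCommGroup F] [NormedSpace ℝ F] [CompleteSpace F]

/-- A function on a group which is a homomorphism up to a quadratic error, and homogeneous of
degree one under a contraction up to a quadratic error, is a homomorphism up to a quadratic
error. -/
theorem exists_hom_of_quadratic_error (T : Γ →* Γ) (f : Γ → F) (r : Γ → ℝ) {S : Set Γ}
    (hS : S ∈ 𝓝 (1 : Γ)) {l m C : ℝ} (hl : 0 < l) (hm : 0 < m) (hml : m ^ 2 < l) (hC : 0 ≤ C)
    (hT : Set.MapsTo T S S) (hT1 : ∀ x, Tendsto (fun n => T^[n] x) atTop (𝓝 1))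
    (hr0 : ∀ x, 0 ≤ r x) (hr : ∀ x ∈ S, r (T x) ≤ m * r x)
    (hf : ∀ x ∈ S, ‖f (T x) - l • f x‖ ≤ C * r x ^ 2)
    (hadd : ∀ x ∈ S, ∀ y ∈ S, ‖f (x * y) - f x - f y‖ ≤ C * (r x + r y) ^ 2)
    (hf1 : Tendsto f (𝓝 1) (𝓝 0)) (hr1 : Tendsto r (𝓝 1) (𝓝 0)) :
    ∃ χ : Γ → F, (∀ x y, χ (x * y) = χ x + χ y) ∧ Continuous χ ∧
      ∃ C' : ℝ, ∀ x ∈ S, ‖χ x - f x‖ ≤ C' * r x ^ 2 := by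
  -- The homomorphism is χ(x) = lim l⁻ⁿ f(Tⁿ x). The quadratic errors at Tⁿ x have size m²ⁿ, so
  -- after rescaling they are O((m²/l)ⁿ): summable, and in the additivity defect vanishing in the
  -- limit, because m² < l.
  set a : Γ → ℕ → F := fun x n => (l⁻¹) ^ n • f (T^[n] x) with ha
  have hTS : ∀ x ∈ S, ∀ n, T^[n] x ∈ S := fun x hx n => hT.iterate n hx
  have hrn : ∀ x ∈ S, ∀ n, r (T^[n] x) ≤ m ^ n * r x := by
    intro x hx n
    induction n with
    | zero => simp
    | succ n ih =>
      rw [Function.iterate_succ_apply', pow_succ']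
      calc r (T (T^[n] x)) ≤ m * r (T^[n] x) := hr _ (hTS x hx n)
        _ ≤ m * (m ^ n * r x) := by gcongr
        _ = _ := by ring
  have hstep : ∀ x ∈ S, ∀ n, dist (a x n) (a x (n + 1)) ≤
      (l⁻¹ * C * r x ^ 2) * (m ^ 2 / l) ^ n := by
    intro x hx n
    have e : a x (n + 1) - a x n = (l⁻¹) ^ (n + 1) • (f (T (T^[n] x)) - l • f (T^[n] x)) := by
      simp only [ha]
      rw [Function.iterate_succ_apply', smul_sub, smul_smul, pow_succ, mul_assoc,
        inv_mul_cancel₀ hl.ne', mul_one]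
    rw [dist_comm, dist_eq_norm, e, norm_smul, Real.norm_of_nonneg (by positivity)]
    calc (l⁻¹) ^ (n + 1) * ‖f (T (T^[n] x)) - l • f (T^[n] x)‖
        ≤ (l⁻¹) ^ (n + 1) * (C * (m ^ n * r x) ^ 2) := by
          gcongr
          refine (hf _ (hTS x hx n)).trans ?_
          have := hrn x hx n
          have := hr0 (T^[n] x)
          gcongr
      _ = _ := by
          rw [div_pow, ← pow_mul, mul_pow, ← pow_mul, pow_succ, mul_comm 2 n, inv_pow]
          field_simp
  have hq : m ^ 2 / l < 1 := (div_lt_one hl).2 hml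
  have hev : ∀ x, ∃ N, T^[N] x ∈ S := fun x => ((hT1 x).eventually hS).exists
  have hshift : ∀ x N n, a x (n + N) = (l⁻¹) ^ N • a (T^[N] x) n := by
    intro x N n
    simp only [ha]
    rw [smul_smul, ← pow_add, Function.iterate_add_apply, add_comm N n]
  -- The estimates hold only on S, but every orbit enters S, and dropping finitely many iterates
  -- rescales the sequence by a constant.
  have hconv : ∀ x, ∃ y, Tendsto (a x) atTop (𝓝 y) := by
    intro x
    obtain ⟨N, hN⟩ := hev x
    obtain ⟨y, hy⟩ := cauchySeq_tendsto_of_complete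
      (cauchySeq_of_le_geometric _ _ hq (hstep _ hN))
    refine ⟨(l⁻¹) ^ N • y, (tendsto_add_atTop_iff_nat N).1 ?_⟩
    simp only [hshift]
    exact hy.const_smul _
  choose χ hχ using hconv
  have hclose : ∀ x ∈ S, ‖χ x - f x‖ ≤ (l⁻¹ * C / (1 - m ^ 2 / l)) * r x ^ 2 := by
    intro x hx
    have h := dist_le_of_le_geometric_of_tendsto₀ _ _ hq (hstep x hx) (hχ x)
    rw [dist_comm, dist_eq_norm] at h
    simpa [ha, div_mul_eq_mul_div, mul_assoc] using h
  have hrate : ∀ x, ∃ k : ℝ, 0 ≤ k ∧ ∀ᶠ n in atTop, T^[n] x ∈ S ∧ r (T^[n] x) ≤ k * m ^ n := by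
    intro x
    obtain ⟨N, hN⟩ := hev x
    refine ⟨r (T^[N] x) / m ^ N, div_nonneg (hr0 _) (by positivity), ?_⟩
    filter_upwards [eventually_ge_atTop N] with n hn
    obtain ⟨j, rfl⟩ := Nat.exists_eq_add_of_le' hn
    rw [Function.iterate_add_apply]
    refine ⟨hTS _ hN _, (hrn _ hN _).trans (le_of_eq ?_)⟩
    rw [pow_add]
    field_simp
  have hχadd : ∀ x y, χ (x * y) = χ x + χ y := by
    intro x y
    obtain ⟨k, hk0, hk⟩ := hrate x
    obtain ⟨k', hk0', hk'⟩ := hrate y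
    have h1 := ((hχ (x * y)).sub (hχ x)).sub (hχ y)
    have h2 : Tendsto (fun n => a (x * y) n - a x n - a y n) atTop (𝓝 0) := by
      have h3 : Tendsto (fun n : ℕ => (C * (k + k') ^ 2) * (m ^ 2 / l) ^ n) atTop (𝓝 0) := by
        simpa using (tendsto_pow_atTop_nhds_zero_of_lt_one (by positivity) hq).const_mul
          (C * (k + k') ^ 2)
      refine squeeze_zero_norm' ?_ h3
      filter_upwards [hk, hk'] with n hn hn'
      have e : a (x * y) n - a x n - a y n =
          (l⁻¹) ^ n • (f (T^[n] x * T^[n] y) - f (T^[n] x) - f (T^[n] y)) := by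
        simp only [ha, smul_sub, iterate_map_mul]
      rw [e, norm_smul, Real.norm_of_nonneg (by positivity)]
      have := hr0 (T^[n] x)
      have := hr0 (T^[n] y)
      calc (l⁻¹) ^ n * ‖f (T^[n] x * T^[n] y) - f (T^[n] x) - f (T^[n] y)‖
          ≤ (l⁻¹) ^ n * (C * (k * m ^ n + k' * m ^ n) ^ 2) := by
            gcongr
            refine (hadd _ hn.1 _ hn'.1).trans ?_
            gcongr
            · exact hn.2
            · exact hn'.2
        _ = _ := by
          rw [div_pow, ← pow_mul, ← add_mul, mul_pow, ← pow_mul, mul_comm 2 n, inv_pow]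
          field_simp
    have h4 := tendsto_nhds_unique h1 h2
    rw [sub_sub, sub_eq_zero] at h4
    exact h4
  refine ⟨χ, hχadd, ?_, _, hclose⟩
  have hχ1 : χ 1 = 0 := by simpa using hχadd 1 1
  have hlim : Tendsto χ (𝓝 1) (𝓝 0) := by
    have h3 : Tendsto (fun x => (l⁻¹ * C / (1 - m ^ 2 / l)) * r x ^ 2) (𝓝 1) (𝓝 0) := by
      simpa using (hr1.pow 2).const_mul (l⁻¹ * C / (1 - m ^ 2 / l))
    have h4 : Tendsto (fun x => χ x - f x) (𝓝 1) (𝓝 0) :=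
      squeeze_zero_norm' (by filter_upwards [hS] with x hx using hclose x hx) h3
    simpa using h4.add hf1
  refine continuous_iff_continuousAt.2 fun x => ?_
  have h5 : Tendsto (fun y => x⁻¹ * y) (𝓝 x) (𝓝 1) := by
    have : Continuous fun y : Γ => x⁻¹ * y := continuous_const.mul continuous_id
    simpa using this.tendsto x
  have h6 := (hlim.comp h5).const_add (χ x)
  rw [add_zero] at h6
  refine h6.congr fun y => ?_
  rw [Function.comp_apply, ← hχadd, mul_inv_cancel_left]

end AlmostHom

/-! ### Multiplication, conjugation and Ad in a chart at the identity -/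

namespace LieCoord

open Filter Topology

section Defs

variable (n : ℕ) {N : Type*} [Group N] [TopologicalSpace N]
  [ChartedSpace (EuclideanSpace ℝ (Fin n)) N]

/-- The preferred chart at the identity, translated so that the identity has coordinate `0`. -/
noncomputable def coord (x : N) : EuclideanSpace ℝ (Fin n) :=
  extChartAt (𝓡 n) (1 : N) x - extChartAt (𝓡 n) (1 : N) 1

variable (N) in
/-- The inverse of `coord`. -/
noncomputable def pt (u : EuclideanSpace ℝ (Fin n)) : N :=
  (extChartAt (𝓡 n) (1 : N)).symm (u + extChartAt (𝓡 n) (1 : N) 1)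

/-- The adjoint action in the coordinates `coord`. -/
noncomputable def Ad (g : N) : EuclideanSpace ℝ (Fin n) →L[ℝ] EuclideanSpace ℝ (Fin n) :=
  fderiv ℝ (fun u => coord n (g * pt n N u * g⁻¹)) 0

end Defs

variable {n : ℕ} {N : Type*} [Group N] [TopologicalSpace N]
  [ChartedSpace (EuclideanSpace ℝ (Fin n)) N]

@[simp]
theorem coord_one : coord n (1 : N) = 0 := sub_self _

@[simp]
theorem pt_zero : pt n N 0 = 1 := by
  rw [pt, zero_add, extChartAt_to_inv]

theorem eventually_pt_coord : ∀ᶠ x : N in 𝓝 1, pt n N (coord n x) = x := by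
  filter_upwards [extChartAt_source_mem_nhds (I := 𝓡 n) (1 : N)] with x hx
  rw [pt, coord, sub_add_cancel, PartialEquiv.left_inv _ hx]

theorem tendsto_add_chart_one :
    Tendsto (fun u => u + extChartAt (𝓡 n) (1 : N) 1) (𝓝 0) (𝓝 (extChartAt (𝓡 n) (1 : N) 1)) := by
  have : Continuous fun u => u + extChartAt (𝓡 n) (1 : N) 1 := continuous_id.add continuous_const
  simpa using this.tendsto 0

theorem eventually_coord_pt :
    ∀ᶠ u : EuclideanSpace ℝ (Fin n) in 𝓝 0, coord n (pt n N u) = u := by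
  filter_upwards [tendsto_add_chart_one.eventually
    (extChartAt_target_mem_nhds (I := 𝓡 n) (1 : N))] with u hu
  rw [pt, coord, PartialEquiv.right_inv _ hu, add_sub_cancel_right]

theorem contMDiffAt_coord :
    ContMDiffAt (𝓡 n) 𝓘(ℝ, EuclideanSpace ℝ (Fin n)) ∞ (coord n : N → _) 1 :=
  (contMDiffAt_extChartAt (I := 𝓡 n) (x := (1 : N))).sub contMDiffAt_const

theorem continuousAt_coord : ContinuousAt (coord n : N → _) 1 := contMDiffAt_coord.continuousAt

theorem tendsto_coord : Tendsto (coord n : N → _) (𝓝 1) (𝓝 0) := by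
  simpa [ContinuousAt] using continuousAt_coord (n := n) (N := N)

theorem contDiffAt_coord_comp {P : Type*} [NormedAddCommGroup P] [NormedSpace ℝ P]
    {f : P → N} {x : P} (hf : ContMDiffAt 𝓘(ℝ, P) (𝓡 n) ∞ f x) (h1 : f x = 1) :
    ContDiffAt ℝ ∞ (fun p => coord n (f p)) x :=
  (contMDiffAt_coord.comp_of_eq hf h1).contDiffAt

variable [LieGroup (𝓡 n) ∞ N]

theorem contMDiffAt_pt :
    ContMDiffAt 𝓘(ℝ, EuclideanSpace ℝ (Fin n)) (𝓡 n) ∞ (pt n N) 0 := by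
  have h := (contMDiffOn_extChartAt_symm (n := ∞) (I := 𝓡 n) (1 : N)).contMDiffAt
    (extChartAt_target_mem_nhds (I := 𝓡 n) (1 : N))
  refine ContMDiffAt.comp_of_eq (g := (extChartAt (𝓡 n) (1 : N)).symm) h ?_ (zero_add _)
  exact contMDiffAt_id.add contMDiffAt_const

theorem continuousAt_pt : ContinuousAt (pt n N) 0 := contMDiffAt_pt.continuousAt

theorem tendsto_pt : Tendsto (pt n N) (𝓝 0) (𝓝 1) := by
  simpa [ContinuousAt] using continuousAt_pt (n := n) (N := N)

theorem contMDiffAt_pt_comp {P : Type*} [NormedAddCommGroup P] [NormedSpace ℝ P]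
    {f : P → EuclideanSpace ℝ (Fin n)} {x : P} (hf : ContDiffAt ℝ ∞ f x) (h1 : f x = 0) :
    ContMDiffAt 𝓘(ℝ, P) (𝓡 n) ∞ (fun p => pt n N (f p)) x :=
  contMDiffAt_pt.comp_of_eq hf.contMDiffAt h1

/-- The multiplication in coordinates is smooth near `0`. -/
theorem contDiffAt_mul : ContDiffAt ℝ ∞
    (fun p : EuclideanSpace ℝ (Fin n) × EuclideanSpace ℝ (Fin n) =>
      coord n (pt n N p.1 * pt n N p.2)) 0 :=
  contDiffAt_coord_comp ((contMDiffAt_pt_comp contDiffAt_fst rfl).mul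
    (contMDiffAt_pt_comp contDiffAt_snd rfl)) (by simp)

/-- The conjugation in coordinates is smooth near `0`. -/
theorem contDiffAt_conj : ContDiffAt ℝ ∞
    (fun p : EuclideanSpace ℝ (Fin n) × EuclideanSpace ℝ (Fin n) =>
      coord n (pt n N p.1 * pt n N p.2 * (pt n N p.1)⁻¹)) 0 :=
  contDiffAt_coord_comp (((contMDiffAt_pt_comp contDiffAt_fst rfl).mul
    (contMDiffAt_pt_comp contDiffAt_snd rfl)).mul
      (contMDiffAt_pt_comp contDiffAt_fst rfl).inv) (by simp)

theorem contDiffAt_conj_left (g : N) :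
    ContDiffAt ℝ ∞ (fun u => coord n (g * pt n N u * g⁻¹)) 0 :=
  contDiffAt_coord_comp ((contMDiffAt_const.mul contMDiffAt_pt).mul contMDiffAt_const) (by simp)

theorem hasStrictFDerivAt_conj (g : N) :
    HasStrictFDerivAt (fun u => coord n (g * pt n N u * g⁻¹)) (Ad n g) 0 :=
  (contDiffAt_conj_left g).hasStrictFDerivAt (by simp)

/-- Each partial derivative is the identity because multiplying by the point of coordinate 0 changes
nothing. To first order the group law is addition. -/
theorem hasStrictFDerivAt_mul :
    HasStrictFDerivAt (fun p : EuclideanSpace ℝ (Fin n) × EuclideanSpace ℝ (Fin n) =>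
      coord n (pt n N p.1 * pt n N p.2))
      (ContinuousLinearMap.fst ℝ _ _ + ContinuousLinearMap.snd ℝ _ _) 0 := by
  have h := (contDiffAt_mul (n := n) (N := N)).hasStrictFDerivAt (by simp)
  set D := fderiv ℝ (fun p : EuclideanSpace ℝ (Fin n) × EuclideanSpace ℝ (Fin n) =>
      coord n (pt n N p.1 * pt n N p.2)) 0
  have h1 : D.comp (ContinuousLinearMap.inl ℝ _ _) = ContinuousLinearMap.id ℝ _ := by
    have h2 := HasFDerivAt.comp (f := fun u => (u, (0 : EuclideanSpace ℝ (Fin n))))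
      (0 : EuclideanSpace ℝ (Fin n)) h.hasFDerivAt
      (ContinuousLinearMap.inl ℝ (EuclideanSpace ℝ (Fin n)) (EuclideanSpace ℝ (Fin n))).hasFDerivAt
    refine h2.unique ((hasFDerivAt_id _).congr_of_eventuallyEq ?_)
    filter_upwards [eventually_coord_pt (n := n) (N := N)] with u hu
    simp [hu]
  have h3 : D.comp (ContinuousLinearMap.inr ℝ _ _) = ContinuousLinearMap.id ℝ _ := by
    have h2 := HasFDerivAt.comp (f := fun u => ((0 : EuclideanSpace ℝ (Fin n)), u))
      (0 : EuclideanSpace ℝ (Fin n)) h.hasFDerivAt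
      (ContinuousLinearMap.inr ℝ (EuclideanSpace ℝ (Fin n)) (EuclideanSpace ℝ (Fin n))).hasFDerivAt
    refine h2.unique ((hasFDerivAt_id _).congr_of_eventuallyEq ?_)
    filter_upwards [eventually_coord_pt (n := n) (N := N)] with u hu
    simp [hu]
  have h4 : D = ContinuousLinearMap.fst ℝ _ _ + ContinuousLinearMap.snd ℝ _ _ := by
    refine ContinuousLinearMap.ext fun p => ?_
    have e : p = ContinuousLinearMap.inl ℝ _ _ p.1 + ContinuousLinearMap.inr ℝ _ _ p.2 := by simp
    conv_lhs => rw [e, map_add]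
    exact congrArg₂ (· + ·) (DFunLike.congr_fun h1 p.1)
      (DFunLike.congr_fun h3 p.2)
  rwa [h4] at h

theorem Ad_one : Ad n (1 : N) = 1 := by
  refine (hasStrictFDerivAt_conj (1 : N)).hasFDerivAt.unique
    ((hasFDerivAt_id _).congr_of_eventuallyEq ?_)
  filter_upwards [eventually_coord_pt (n := n) (N := N)] with u hu
  simp [hu]

variable [IsTopologicalGroup N]

theorem Ad_mul (g h : N) : Ad n (g * h) = Ad n g * Ad n h := by
  have h1 : HasFDerivAt (fun u => coord n (g * pt n N (coord n (h * pt n N u * h⁻¹)) * g⁻¹))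
      (Ad n g * Ad n h) 0 := by
    refine HasFDerivAt.comp (g := fun u => coord n (g * pt n N u * g⁻¹)) _ ?_
      (hasStrictFDerivAt_conj h).hasFDerivAt
    simpa using (hasStrictFDerivAt_conj g).hasFDerivAt
  refine (hasStrictFDerivAt_conj (g * h)).hasFDerivAt.unique (h1.congr_of_eventuallyEq ?_)
  have h2 : Tendsto (fun u => h * pt n N u * h⁻¹) (𝓝 0) (𝓝 1) := by
    simpa using ((tendsto_pt (n := n)).const_mul h).mul_const h⁻¹
  filter_upwards [h2.eventually (eventually_pt_coord (n := n))] with u hu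
  rw [hu]
  simp only [mul_inv_rev, mul_assoc]

/-- Two curves in a Lie group, written to the left of their values at a point: the product rule. -/
theorem hasStrictFDerivAt_log_mul {P : Type*} [NormedAddCommGroup P] [NormedSpace ℝ P]
    {g h : P → N} {x : P} (hgc : ContinuousAt g x) (hhc : ContinuousAt h x)
    {L M : P →L[ℝ] EuclideanSpace ℝ (Fin n)}
    (hg : HasStrictFDerivAt (fun t => coord n ((g x)⁻¹ * g t)) L x)
    (hh : HasStrictFDerivAt (fun t => coord n ((h x)⁻¹ * h t)) M x) :
    HasStrictFDerivAt (fun t => coord n ((g x * h x)⁻¹ * (g t * h t)))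
      ((Ad n (h x)⁻¹).comp L + M) x := by
  have hg1 : Tendsto (fun t => (g x)⁻¹ * g t) (𝓝 x) (𝓝 1) := by
    simpa using hgc.tendsto.const_mul (g x)⁻¹
  have hh1 : Tendsto (fun t => (h x)⁻¹ * h t) (𝓝 x) (𝓝 1) := by
    simpa using hhc.tendsto.const_mul (h x)⁻¹
  have h1 : HasStrictFDerivAt
      (fun t => coord n ((h x)⁻¹ * pt n N (coord n ((g x)⁻¹ * g t)) * ((h x)⁻¹)⁻¹))
      ((Ad n (h x)⁻¹).comp L) x := by
    refine HasStrictFDerivAt.comp (g := fun u => coord n ((h x)⁻¹ * pt n N u * ((h x)⁻¹)⁻¹)) _ ?_ hg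
    simpa using hasStrictFDerivAt_conj (n := n) (h x)⁻¹
  have h2 := HasStrictFDerivAt.comp (g := fun p : EuclideanSpace ℝ (Fin n) × EuclideanSpace ℝ (Fin n)
    => coord n (pt n N p.1 * pt n N p.2)) x (by
      simpa using! hasStrictFDerivAt_mul (n := n) (N := N)) (h1.prodMk hh)
  have e : (ContinuousLinearMap.fst ℝ (EuclideanSpace ℝ (Fin n)) (EuclideanSpace ℝ (Fin n)) +
      ContinuousLinearMap.snd ℝ _ _).comp (((Ad n (h x)⁻¹).comp L).prod M) =
      (Ad n (h x)⁻¹).comp L + M := rfl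
  rw [e] at h2
  -- With g = g(x), h = h(x): (gh)⁻¹ g(t) h(t) = [h⁻¹ (g⁻¹ g(t)) h] · [h⁻¹ h(t)]. The first bracket
  -- differentiates to Ad(h⁻¹) L, and the product to a sum.
  refine h2.congr_of_eventuallyEq ?_
  have h3 : Tendsto (fun t => (h x)⁻¹ * ((g x)⁻¹ * g t) * ((h x)⁻¹)⁻¹) (𝓝 x) (𝓝 1) := by
    simpa using (hg1.const_mul (h x)⁻¹).mul_const ((h x)⁻¹)⁻¹
  filter_upwards [hg1.eventually (eventually_pt_coord (n := n)),
    hh1.eventually (eventually_pt_coord (n := n)),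
    h3.eventually (eventually_pt_coord (n := n))] with t h4 h5 h6
  simp only [h4, h5, h6]
  congr 1
  group

end LieCoord

/-! ### The derivative of Ad is the Lie bracket -/

open Filter Topology in
/-- The second order relation between a local multiplication `M` and its conjugation `C`: the
derivative of the adjoint action is the antisymmetrization of the second derivative of `M`. -/
theorem fderiv_fderiv_conj_eq {E : Type*} [NormedAddCommGroup E] [NormedSpace ℝ E]
    {M C : E × E → E} (hM : ContDiffAt ℝ ∞ M 0) (hC : ContDiffAt ℝ ∞ C 0)
    (hM1 : ∀ᶠ u in 𝓝 (0 : E), M (u, 0) = u) (hC1 : ∀ᶠ u in 𝓝 (0 : E), C (u, 0) = 0)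
    (hC0 : ∀ᶠ u in 𝓝 (0 : E), C (0, u) = u)
    (hMC : ∀ᶠ p in 𝓝 (0 : E × E), M p = M (C p, p.1)) (X Y : E) :
    fderiv ℝ (fderiv ℝ C) 0 (X, 0) (0, Y) =
      fderiv ℝ (fderiv ℝ M) 0 (X, 0) (0, Y) - fderiv ℝ (fderiv ℝ M) 0 (Y, 0) (0, X) := by
  have hinl : HasFDerivAt (fun u : E => (u, (0 : E))) (ContinuousLinearMap.inl ℝ E E) 0 :=
    (ContinuousLinearMap.inl ℝ E E).hasFDerivAt
  have hinr : HasFDerivAt (fun u : E => ((0 : E), u)) (ContinuousLinearMap.inr ℝ E E) 0 :=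
    (ContinuousLinearMap.inr ℝ E E).hasFDerivAt
  have tinl : Tendsto (fun u : E => (u, (0 : E))) (𝓝 0) (𝓝 0) := hinl.continuousAt.tendsto
  have tinr : Tendsto (fun u : E => ((0 : E), u)) (𝓝 0) (𝓝 0) := hinr.continuousAt.tendsto
  have key : ∀ {Q : E × E → E}, ContDiffAt ℝ ∞ Q 0 →
      HasFDerivAt (fderiv ℝ Q) (fderiv ℝ (fderiv ℝ Q) 0) 0 := fun hQ =>
    ((hQ.fderiv_right (m := 1) (by norm_cast)).differentiableAt (by simp)).hasFDerivAt
  have evd : ∀ {Q : E × E → E}, ContDiffAt ℝ ∞ Q 0 →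
      ∀ᶠ p in 𝓝 (0 : E × E), HasFDerivAt Q (fderiv ℝ Q p) p := fun hQ => by
    filter_upwards [(hQ.of_le (m := 1) (by norm_cast)).eventually (by simp)] with p hp
    exact (hp.differentiableAt (by simp)).hasFDerivAt
  -- The hypothesis `hMC` encodes uv = (uvu⁻¹)u. It is differentiated in the second variable at (u,
  -- 0), here, and then in u at 0; symmetry of the second derivative of M finishes.
  have h1 : ∀ᶠ u in 𝓝 (0 : E),
      fderiv ℝ M (u, 0) (0, Y) = fderiv ℝ M (0, u) (fderiv ℝ C (u, 0) (0, Y), 0) := by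
    filter_upwards [tinl.eventually (evd hM), tinr.eventually (evd hM), tinl.eventually (evd hC),
      tinl.eventually hMC.eventually_nhds, hC1] with u hu1 hu2 hu3 hu4 hu5
    have a : HasFDerivAt (fun p : E × E => M (C p, p.1))
        ((fderiv ℝ M (0, u)).comp ((fderiv ℝ C (u, 0)).prod (ContinuousLinearMap.fst ℝ E E)))
        (u, 0) := by
      refine HasFDerivAt.comp (g := M) (u, (0 : E)) ?_ (hu3.prodMk hasFDerivAt_fst)
      simpa [hu5] using hu2
    exact DFunLike.congr_fun (hu1.unique (a.congr_of_eventuallyEq hu4)) ((0 : E), Y)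
  have a1 : HasFDerivAt (fun u : E => fderiv ℝ M (u, 0) (0, Y))
      (((fderiv ℝ (fderiv ℝ M) 0).comp (ContinuousLinearMap.inl ℝ E E)).flip (0, Y)) 0 := by
    have := (HasFDerivAt.comp (g := fderiv ℝ M)
      (f := fun u : E => (u, (0 : E))) (0 : E) (key hM) hinl).clm_apply
      (hasFDerivAt_const ((0 : E), Y) 0)
    rw [ContinuousLinearMap.comp_zero, zero_add] at this
    exact this
  have a2 : HasFDerivAt (fun u : E => fderiv ℝ C (u, 0) (0, Y))
      (((fderiv ℝ (fderiv ℝ C) 0).comp (ContinuousLinearMap.inl ℝ E E)).flip (0, Y)) 0 := by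
    have := (HasFDerivAt.comp (g := fderiv ℝ C)
      (f := fun u : E => (u, (0 : E))) (0 : E) (key hC) hinl).clm_apply
      (hasFDerivAt_const ((0 : E), Y) 0)
    rw [ContinuousLinearMap.comp_zero, zero_add] at this
    exact this
  have a3 := (HasFDerivAt.comp (g := fderiv ℝ M) (f := fun u : E => ((0 : E), u)) (0 : E)
    (key hM) hinr).clm_apply
    (a2.prodMk (hasFDerivAt_const (0 : E) 0))
  have h2 := DFunLike.congr_fun ((a1.congr_of_eventuallyEq
    (h1.mono fun u hu => hu.symm)).unique a3) X
  have hM0 : ∀ v, fderiv ℝ M 0 (v, 0) = v := fun v => by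
    have h3 := HasFDerivAt.comp (g := M) (f := fun u : E => (u, (0 : E))) (0 : E)
      (evd hM).self_of_nhds hinl
    exact DFunLike.congr_fun (h3.unique ((hasFDerivAt_id _).congr_of_eventuallyEq hM1)) v
  have hC0' : ∀ v, fderiv ℝ C 0 (0, v) = v := fun v => by
    have h3 := HasFDerivAt.comp (g := C) (f := fun u : E => ((0 : E), u)) (0 : E)
      (evd hC).self_of_nhds hinr
    exact DFunLike.congr_fun (h3.unique ((hasFDerivAt_id _).congr_of_eventuallyEq hC0)) v
  have hsymm : IsSymmSndFDerivAt ℝ M 0 := hM.isSymmSndFDerivAt (by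
    rw [minSmoothness_of_isRCLikeNormedField]; exact ENat.LEInfty.out)
  simp only [ContinuousLinearMap.flip_apply, ContinuousLinearMap.comp_apply,
    ContinuousLinearMap.inl_apply, ContinuousLinearMap.inr_apply, Function.comp_apply,
    add_apply, ContinuousLinearMap.prod_apply,
    zero_apply, Prod.mk_zero_zero, hM0, hC0'] at h2
  rw [h2, hsymm (Y, 0) (0, X)]
  abel

open Filter Topology in
/-- The second partial derivative of a smooth function of two variables, differentiated in the
first variable. -/
theorem exists_hasFDerivAt_fderiv_right {E : Type*} [NormedAddCommGroup E] [NormedSpace ℝ E]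
    {Q : E × E → E} (hQ : ContDiffAt ℝ ∞ Q 0) :
    ∃ D : E →L[ℝ] E →L[ℝ] E, HasFDerivAt (fun u => fderiv ℝ (fun v => Q (u, v)) 0) D 0 ∧
      ∀ X Y, D X Y = fderiv ℝ (fderiv ℝ Q) 0 (X, 0) (0, Y) := by
  have hinl : HasFDerivAt (fun u : E => (u, (0 : E))) (ContinuousLinearMap.inl ℝ E E) 0 :=
    (ContinuousLinearMap.inl ℝ E E).hasFDerivAt
  have key : HasFDerivAt (fderiv ℝ Q) (fderiv ℝ (fderiv ℝ Q) 0) 0 :=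
    ((hQ.fderiv_right (m := 1) (by norm_cast)).differentiableAt (by simp)).hasFDerivAt
  have h := HasFDerivAt.comp (g := fderiv ℝ Q) (f := fun u : E => (u, (0 : E))) (0 : E) key hinl
  set R := (ContinuousLinearMap.compL ℝ E (E × E) E).flip (ContinuousLinearMap.inr ℝ E E)
  have hR := HasFDerivAt.comp (0 : E) R.hasFDerivAt h
  refine ⟨_, hR.congr_of_eventuallyEq ?_, fun X Y => rfl⟩
  have tinl : Tendsto (fun u : E => (u, (0 : E))) (𝓝 0) (𝓝 0) := hinl.continuousAt.tendsto
  filter_upwards [tinl.eventually ((hQ.of_le (m := 1) (by norm_cast)).eventually (by simp))]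
    with u hu
  exact (HasFDerivAt.comp (g := Q) (f := fun v => (u, v)) (0 : E)
    (hu.differentiableAt (by simp)).hasFDerivAt (hasFDerivAt_prodMk_right u 0)).fderiv

namespace LieCoord

open Filter Topology VectorField

variable {n : ℕ} {N : Type*} [Group N] [TopologicalSpace N]
  [ChartedSpace (EuclideanSpace ℝ (Fin n)) N]

/-- Passage from manifold derivatives to ordinary ones: the tangent space at the identity is the
model space, and `pt` is the inverse chart shifted by a constant. -/
theorem mfderiv_one_apply {E' : Type*} [NormedAddCommGroup E'] [NormedSpace ℝ E'] {f : N → E'}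
    (hf : MDifferentiableAt (𝓡 n) 𝓘(ℝ, E') f 1) (X : EuclideanSpace ℝ (Fin n)) :
    (mfderiv (𝓡 n) 𝓘(ℝ, E') f 1 : EuclideanSpace ℝ (Fin n) →L[ℝ] E') X =
      fderiv ℝ (fun u => f (pt n N u)) 0 X := by
  have h1 := hf.mfderiv
  have h2 : fderivWithin ℝ (writtenInExtChartAt (𝓡 n) 𝓘(ℝ, E') 1 f) (Set.range (𝓡 n))
      (extChartAt (𝓡 n) (1 : N) 1) = fderiv ℝ (fun y => f ((extChartAt (𝓡 n) (1 : N)).symm y))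
        (extChartAt (𝓡 n) (1 : N) 1) := by
    rw [ModelWithCorners.range_eq_univ, fderivWithin_univ]
    rfl
  have h3 : fderiv ℝ (fun u => f (pt n N u)) 0 =
      fderiv ℝ (fun y => f ((extChartAt (𝓡 n) (1 : N)).symm y))
        (0 + extChartAt (𝓡 n) (1 : N) 1) :=
    fderiv_comp_add_right (f := fun y => f ((extChartAt (𝓡 n) (1 : N)).symm y)) (x := 0)
      (extChartAt (𝓡 n) (1 : N) 1)
  rw [h3, zero_add]
  exact DFunLike.congr_fun (h1.trans h2) X

/-- The left-invariant field of X, read in the chart, is the derivative of the coordinate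
multiplication in its second variable. Pulling back by the inverse chart amounts to applying the
derivative of the chart, after which the chain rule applies. -/
theorem fderiv_coord_mul_eq [LieGroup (𝓡 n) ∞ N] (X : EuclideanSpace ℝ (Fin n)) :
    ∀ᶠ y in 𝓝 (extChartAt (𝓡 n) (1 : N) 1),
      (mpullbackWithin 𝓘(ℝ, EuclideanSpace ℝ (Fin n)) (𝓡 n) (extChartAt (𝓡 n) (1 : N)).symm
        (mulInvariantVectorField (I := 𝓡 n) (G := N) X) (Set.range (𝓡 n)) y :
          EuclideanSpace ℝ (Fin n)) =
      fderiv ℝ (fun v => coord n (pt n N (y - extChartAt (𝓡 n) (1 : N) 1) * pt n N v)) 0 X := by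
  filter_upwards [extChartAt_target_mem_nhds (I := 𝓡 n) (1 : N)] with y hy
  set φ := extChartAt (𝓡 n) (1 : N) with hφ
  set g := φ.symm y with hg
  have hgp : pt n N (y - φ 1) = g := by rw [pt, sub_add_cancel]
  have hgs : g ∈ φ.source := φ.map_target hy
  have hφg : MDifferentiableAt (𝓡 n) 𝓘(ℝ, EuclideanSpace ℝ (Fin n)) φ g :=
    mdifferentiableAt_extChartAt (by rwa [← extChartAt_source (I := 𝓡 n)])
  have hmul : MDifferentiableAt (𝓡 n) (𝓡 n) (fun x : N => g * x) 1 :=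
    (contMDiff_mul_left (I := 𝓡 n) (n := ∞)).contMDiffAt.mdifferentiableAt (by simp)
  have hinv : (mfderivWithin 𝓘(ℝ, EuclideanSpace ℝ (Fin n)) (𝓡 n) φ.symm
      (Set.range (𝓡 n)) y).inverse = mfderiv (𝓡 n) 𝓘(ℝ, EuclideanSpace ℝ (Fin n)) φ g :=
    ContinuousLinearMap.inverse_eq
      (mfderivWithin_extChartAt_symm_comp_mfderiv_extChartAt hy)
      (mfderiv_extChartAt_comp_mfderivWithin_extChartAt_symm hy)
  have h1 : (mpullbackWithin 𝓘(ℝ, EuclideanSpace ℝ (Fin n)) (𝓡 n) φ.symm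
        (mulInvariantVectorField (I := 𝓡 n) (G := N) X) (Set.range (𝓡 n)) y :
          EuclideanSpace ℝ (Fin n)) =
      (mfderiv (𝓡 n) 𝓘(ℝ, EuclideanSpace ℝ (Fin n)) φ g :
        EuclideanSpace ℝ (Fin n) →L[ℝ] EuclideanSpace ℝ (Fin n))
        ((mfderiv (𝓡 n) (𝓡 n) (fun x : N => g * x) 1 :
          EuclideanSpace ℝ (Fin n) →L[ℝ] EuclideanSpace ℝ (Fin n)) X) :=
    DFunLike.congr_fun hinv _
  have hφg' : MDifferentiableAt (𝓡 n) 𝓘(ℝ, EuclideanSpace ℝ (Fin n)) φ (g * 1) := by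
    rwa [mul_one]
  have hcomp := mfderiv_comp (I'' := 𝓘(ℝ, EuclideanSpace ℝ (Fin n))) (1 : N) hφg' hmul
  have h2 := mfderiv_one_apply (hφg'.comp (1 : N) hmul) X
  have h3 : (fun v => coord n (pt n N (y - φ 1) * pt n N v)) =
      fun v => (φ ∘ fun x : N => g * x) (pt n N v) - φ 1 := by
    rw [hgp]
    rfl
  have h4 : (mfderiv (𝓡 n) 𝓘(ℝ, EuclideanSpace ℝ (Fin n)) φ (g * 1) :
      EuclideanSpace ℝ (Fin n) →L[ℝ] EuclideanSpace ℝ (Fin n)) =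
      (mfderiv (𝓡 n) 𝓘(ℝ, EuclideanSpace ℝ (Fin n)) φ g :
        EuclideanSpace ℝ (Fin n) →L[ℝ] EuclideanSpace ℝ (Fin n)) :=
    congrArg (β := EuclideanSpace ℝ (Fin n) →L[ℝ] EuclideanSpace ℝ (Fin n))
      (fun h : N => (mfderiv (𝓡 n) 𝓘(ℝ, EuclideanSpace ℝ (Fin n)) φ h :
      EuclideanSpace ℝ (Fin n) →L[ℝ] EuclideanSpace ℝ (Fin n))) (mul_one g)
  rw [h3, fderiv_sub_const]
  refine Eq.trans h1 (Eq.trans ?_ h2)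
  exact (DFunLike.congr_fun h4 _).symm.trans (DFunLike.congr_fun hcomp X).symm

/-- The abstract bracket is that of left-invariant fields in the chart. The chart has identity
derivative at its base point, and moving that point to 0 does not change a bracket of vector fields.
-/
theorem bracket_eq_lieBracket [LieGroup (𝓡 n) ∞ N] (X Y : GroupLieAlgebra (𝓡 n) N) :
    (⁅X, Y⁆ : GroupLieAlgebra (𝓡 n) N) =
      lieBracket ℝ
        (fun u => fderiv ℝ (fun v => coord n (pt n N u * pt n N v)) 0 (X : EuclideanSpace ℝ (Fin n)))
        (fun u => fderiv ℝ (fun v => coord n (pt n N u * pt n N v)) 0 (Y : EuclideanSpace ℝ (Fin n)))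
        (0 : EuclideanSpace ℝ (Fin n)) := by
  set c := extChartAt (𝓡 n) (1 : N) 1 with hc
  have hid : ∀ L : EuclideanSpace ℝ (Fin n) →L[ℝ] EuclideanSpace ℝ (Fin n),
      L = ContinuousLinearMap.id ℝ _ → ∀ v, L.inverse v = v := by
    rintro _ rfl v
    rw [ContinuousLinearMap.inverse_id]
    rfl
  have huniv : ∀ A B : EuclideanSpace ℝ (Fin n) → EuclideanSpace ℝ (Fin n),
      lieBracketWithin ℝ A B ((extChartAt (𝓡 n) (1 : N)).symm ⁻¹' Set.univ ∩ Set.range (𝓡 n)) c =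
        lieBracket ℝ A B c := by
    intro A B
    rw [ModelWithCorners.range_eq_univ, Set.preimage_univ, Set.univ_inter, lieBracketWithin_univ]
  have htrans : ∀ A B : EuclideanSpace ℝ (Fin n) → EuclideanSpace ℝ (Fin n),
      lieBracket ℝ (fun y => A (y - c)) (fun y => B (y - c)) c = lieBracket ℝ A B 0 := by
    intro A B
    simp only [lieBracket, fderiv_comp_sub, sub_self]
  refine Eq.trans (hid _ mfderiv_extChartAt_self _) ((huniv _ _).trans ?_)
  exact (Filter.EventuallyEq.lieBracket_vectorField_eq (fderiv_coord_mul_eq X)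
    (fderiv_coord_mul_eq Y)).trans (htrans
      (fun u => fderiv ℝ (fun v => coord n (pt n N u * pt n N v)) 0 (X : EuclideanSpace ℝ (Fin n)))
      (fun u => fderiv ℝ (fun v => coord n (pt n N u * pt n N v)) 0 (Y : EuclideanSpace ℝ (Fin n))))

variable [LieGroup (𝓡 n) ∞ N] [IsTopologicalGroup N]

/-- The derivative of the adjoint action at the identity is the Lie bracket. -/
theorem hasFDerivAt_Ad_pt : ∃ D : EuclideanSpace ℝ (Fin n) →L[ℝ]
    EuclideanSpace ℝ (Fin n) →L[ℝ] EuclideanSpace ℝ (Fin n),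
    HasFDerivAt (fun u => Ad n (pt n N u)) D 0 ∧
      ∀ X Y : GroupLieAlgebra (𝓡 n) N, D X Y = (⁅X, Y⁆ : GroupLieAlgebra (𝓡 n) N) := by
  set M : EuclideanSpace ℝ (Fin n) × EuclideanSpace ℝ (Fin n) → EuclideanSpace ℝ (Fin n) :=
    fun p => coord n (pt n N p.1 * pt n N p.2) with hMdef
  set C : EuclideanSpace ℝ (Fin n) × EuclideanSpace ℝ (Fin n) → EuclideanSpace ℝ (Fin n) :=
    fun p => coord n (pt n N p.1 * pt n N p.2 * (pt n N p.1)⁻¹) with hCdef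
  have hM : ContDiffAt ℝ ∞ M 0 := contDiffAt_mul
  have hC : ContDiffAt ℝ ∞ C 0 := contDiffAt_conj
  obtain ⟨DC, hDC, hDC'⟩ := exists_hasFDerivAt_fderiv_right hC
  obtain ⟨DM, hDM, hDM'⟩ := exists_hasFDerivAt_fderiv_right hM
  refine ⟨DC, hDC, fun X Y => ?_⟩
  have hpt2 : Tendsto (fun p : EuclideanSpace ℝ (Fin n) × EuclideanSpace ℝ (Fin n) =>
      pt n N p.1 * pt n N p.2 * (pt n N p.1)⁻¹) (𝓝 0) (𝓝 1) := by
    have h1 : Tendsto (fun p : EuclideanSpace ℝ (Fin n) × EuclideanSpace ℝ (Fin n) => pt n N p.1)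
        (𝓝 0) (𝓝 1) := tendsto_pt.comp continuous_fst.continuousAt.tendsto
    have h2 : Tendsto (fun p : EuclideanSpace ℝ (Fin n) × EuclideanSpace ℝ (Fin n) => pt n N p.2)
        (𝓝 0) (𝓝 1) := tendsto_pt.comp continuous_snd.continuousAt.tendsto
    simpa using (h1.mul h2).mul h1.inv
  have main := fderiv_fderiv_conj_eq hM hC
    (by
      filter_upwards [eventually_coord_pt (n := n) (N := N)] with u hu
      simp [hMdef, hu])
    (Eventually.of_forall fun u => by simp [hCdef])
    (by
      filter_upwards [eventually_coord_pt (n := n) (N := N)] with u hu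
      simp [hCdef, hu])
    (by
      filter_upwards [hpt2.eventually (eventually_pt_coord (n := n))] with p hp
      simp only [hMdef, hCdef, hp]
      simp) X Y
  refine (hDC' X Y).trans (main.trans (Eq.trans ?_ (bracket_eq_lieBracket X Y).symm))
  have hf : ∀ Z : EuclideanSpace ℝ (Fin n), ∀ W,
      fderiv ℝ (fun u => fderiv ℝ (fun v => coord n (pt n N u * pt n N v)) 0 Z) 0 W =
        fderiv ℝ (fderiv ℝ M) 0 (W, 0) (0, Z) := by
    intro Z W
    have h := (hDM.clm_apply (hasFDerivAt_const Z 0)).fderiv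
    rw [ContinuousLinearMap.comp_zero, zero_add] at h
    exact (DFunLike.congr_fun h W).trans (hDM' W Z)
  have h0 : ∀ Z : EuclideanSpace ℝ (Fin n),
      fderiv ℝ (fun v => coord n (pt n N 0 * pt n N v)) 0 Z = Z := by
    intro Z
    have h : HasFDerivAt (fun v => coord n (pt n N 0 * pt n N v))
        (ContinuousLinearMap.id ℝ (EuclideanSpace ℝ (Fin n))) 0 := by
      refine (hasFDerivAt_id _).congr_of_eventuallyEq ?_
      filter_upwards [eventually_coord_pt (n := n) (N := N)] with u hu
      simp [hu]
    rw [h.fderiv]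
    rfl
  have h1 : ∀ Z W : EuclideanSpace ℝ (Fin n),
      fderiv ℝ (fun u => fderiv ℝ (fun v => coord n (pt n N u * pt n N v)) 0 Z) 0
        (fderiv ℝ (fun v => coord n (pt n N 0 * pt n N v)) 0 W) =
        fderiv ℝ (fderiv ℝ M) 0 (W, 0) (0, Z) := fun Z W => by rw [hf, h0]
  exact (congrArg₂ (fun a b : EuclideanSpace ℝ (Fin n) => a - b) (h1 Y X) (h1 X Y)).symm

end LieCoord

/-! ### Smoothness of continuous one-parameter subgroups -/

open Filter Topology in
/-- The quadratic error term of the first order Taylor expansion of a smooth function. -/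
theorem ContDiffAt.exists_norm_sub_fderiv_le {V F : Type*} [NormedAddCommGroup V] [NormedSpace ℝ V]
    [NormedAddCommGroup F] [NormedSpace ℝ F] {Q : V → F} (hQ : ContDiffAt ℝ ∞ Q 0) :
    ∃ C : ℝ, 0 < C ∧ ∀ᶠ v in 𝓝 (0 : V), ‖Q v - Q 0 - fderiv ℝ Q 0 v‖ ≤ C * ‖v‖ ^ 2 := by
  have h1 : DifferentiableAt ℝ (fderiv ℝ Q) 0 :=
    (hQ.fderiv_right (m := 1) (by norm_cast)).differentiableAt (by simp)
  obtain ⟨C, hC0, hC⟩ := h1.hasFDerivAt.isBigO_sub.exists_pos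
  have h2 : ∀ᶠ v in 𝓝 (0 : V), DifferentiableAt ℝ Q v := by
    filter_upwards [(hQ.of_le (m := 1) (by norm_cast)).eventually (by simp)] with v hv
    exact hv.differentiableAt (by simp)
  obtain ⟨ε, hε, hball⟩ := Metric.eventually_nhds_iff_ball.1 (hC.bound.and h2)
  refine ⟨C, hC0, ?_⟩
  filter_upwards [Metric.ball_mem_nhds (0 : V) hε] with v hv
  have hsub : Metric.closedBall (0 : V) ‖v‖ ⊆ Metric.ball 0 ε := by
    refine Metric.closedBall_subset_ball ?_
    simpa using hv
  -- The derivative varies by at most C‖v‖ on the ball of radius ‖v‖, so the mean value inequality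
  -- costs a second factor ‖v‖.
  have h3 := (convex_closedBall (0 : V) ‖v‖).norm_image_sub_le_of_norm_hasFDerivWithin_le'
    (f := Q) (f' := fderiv ℝ Q) (φ := fderiv ℝ Q 0) (C := C * ‖v‖) (x := 0) (y := v)
    (fun x hx => (hball x (hsub hx)).2.hasFDerivAt.hasFDerivWithinAt)
    (fun x hx => by
      refine (hball x (hsub hx)).1.trans ?_
      rw [sub_zero]
      have : ‖x‖ ≤ ‖v‖ := by simpa using hx
      gcongr)
    (by simp) (by simp)
  rw [sub_zero] at h3
  calc _ ≤ _ := h3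
    _ = _ := by ring

theorem map_zero_of_map_add {Γ : Type*} [Group Γ] {γ : ℝ → Γ}
    (hadd : ∀ s t, γ (s + t) = γ s * γ t) : γ 0 = 1 := by
  simpa using hadd 0 0

namespace LieCoord

open Filter Topology

variable {n : ℕ} {N : Type*} [Group N] [TopologicalSpace N]
  [ChartedSpace (EuclideanSpace ℝ (Fin n)) N] [LieGroup (𝓡 n) ∞ N]

/-- Taylor's formula for the group law. This is the quadratic additivity error required in both
applications of `exists_hom_of_quadratic_error`. -/
theorem exists_norm_coord_mul_sub_le :
    ∃ C : ℝ, 0 < C ∧ ∀ᶠ p : N × N in 𝓝 (1, 1),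
      ‖coord n (p.1 * p.2) - coord n p.1 - coord n p.2‖ ≤
        C * (‖coord n p.1‖ + ‖coord n p.2‖) ^ 2 := by
  obtain ⟨C, hC0, hC⟩ := (contDiffAt_mul (n := n) (N := N)).exists_norm_sub_fderiv_le
  refine ⟨C, hC0, ?_⟩
  have ht : Tendsto (fun p : N × N => (coord n p.1, coord n p.2)) (𝓝 (1, 1))
      (𝓝 (0 : EuclideanSpace ℝ (Fin n) × EuclideanSpace ℝ (Fin n))) := by
    rw [nhds_prod_eq]
    exact (tendsto_coord.comp tendsto_fst).prodMk_nhds (tendsto_coord.comp tendsto_snd)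
  have hp : ∀ᶠ x : N in 𝓝 1, pt n N (coord n x) = x := eventually_pt_coord
  filter_upwards [ht.eventually hC, nhds_prod_eq (x := (1 : N)) (y := (1 : N)) ▸
    hp.prod_mk hp] with p h1 h2
  simp only [hasStrictFDerivAt_mul.hasFDerivAt.fderiv, h2.1, h2.2, Prod.fst_zero, Prod.snd_zero,
    pt_zero, mul_one, coord_one, sub_zero, add_apply, ContinuousLinearMap.coe_fst',
    ContinuousLinearMap.coe_snd'] at h1
  rw [sub_sub]
  refine h1.trans ?_
  gcongr
  exact (max_le_add_of_nonneg (norm_nonneg _) (norm_nonneg _))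

/-- A continuous one-parameter subgroup of a Lie group is differentiable at `0`. -/
theorem exists_hasDerivAt_coord {γ : ℝ → N} (hγ : Continuous γ)
    (hadd : ∀ s t, γ (s + t) = γ s * γ t) :
    ∃ X : EuclideanSpace ℝ (Fin n), HasDerivAt (fun s => coord n (γ s)) X 0 := by
  have hγ0 := map_zero_of_map_add hadd
  have hγt : Tendsto γ (𝓝 0) (𝓝 1) := hγ0 ▸ hγ.tendsto 0
  set f : ℝ → EuclideanSpace ℝ (Fin n) := fun s => coord n (γ s) with hf
  have hf0 : Tendsto f (𝓝 0) (𝓝 0) := tendsto_coord.comp hγt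
  have hr0 : Tendsto (fun s => ‖f s‖) (𝓝 0) (𝓝 0) := by simpa using hf0.norm
  obtain ⟨C, hC0, hC⟩ := exists_norm_coord_mul_sub_le (n := n) (N := N)
  have hev : ∀ᶠ p : ℝ × ℝ in 𝓝 (0, 0),
      ‖f (p.1 + p.2) - f p.1 - f p.2‖ ≤ C * (‖f p.1‖ + ‖f p.2‖) ^ 2 := by
    have ht : Tendsto (fun p : ℝ × ℝ => (γ p.1, γ p.2)) (𝓝 (0, 0)) (𝓝 ((1 : N), (1 : N))) := by
      rw [nhds_prod_eq]
      exact (hγt.comp tendsto_fst).prodMk_nhds (hγt.comp tendsto_snd)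
    filter_upwards [ht.eventually hC] with p hp
    simpa [hf, hadd] using hp
  -- With this bound 2‖f(s/2)‖ ≤ ‖f(s)‖ + ‖f(s/2)‖/3, so halving s contracts ‖f‖ by 3/5. The limit
  -- procedure applies with l = 1/2 and m = 3/5, as 9/25 < 1/2.
  have hsmall : ∀ᶠ s in 𝓝 (0 : ℝ), 4 * C * ‖f s‖ ≤ 1 / 3 := by
    have : Tendsto (fun s => 4 * C * ‖f s‖) (𝓝 0) (𝓝 0) := by simpa using hr0.const_mul (4 * C)
    exact (this.eventually (gt_mem_nhds (by norm_num : (0 : ℝ) < 1 / 3))).mono fun s hs => hs.le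
  rw [nhds_prod_eq] at hev
  obtain ⟨P, hP, Q, hQ, hPQ⟩ := eventually_prod_iff.1 hev
  obtain ⟨ε, hε, hball⟩ := Metric.eventually_nhds_iff_ball.1 (hP.and (hQ.and hsmall))
  have hhalf : ∀ s ∈ Metric.ball (0 : ℝ) ε, 2⁻¹ * s ∈ Metric.ball (0 : ℝ) ε := by
    intro s hs
    rw [mem_ball_zero_iff] at hs ⊢
    rw [norm_mul, norm_inv, Real.norm_two]
    linarith [norm_nonneg s]
  have hdouble : ∀ s ∈ Metric.ball (0 : ℝ) ε,
      ‖f s - (2 : ℝ) • f (2⁻¹ * s)‖ ≤ 4 * C * ‖f (2⁻¹ * s)‖ ^ 2 := by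
    intro s hs
    have h := hPQ (hball _ (hhalf s hs)).1 (hball _ (hhalf s hs)).2.1
    have e : 2⁻¹ * s + 2⁻¹ * s = s := by ring
    rw [e, sub_sub, ← two_smul ℝ] at h
    calc _ ≤ _ := h
      _ = _ := by ring
  have hcontr : ∀ s ∈ Metric.ball (0 : ℝ) ε, ‖f (2⁻¹ * s)‖ ≤ 3 / 5 * ‖f s‖ := by
    intro s hs
    have h1 := hdouble s hs
    have h2 := (hball _ (hhalf s hs)).2.2
    have h3 : ‖(2 : ℝ) • f (2⁻¹ * s)‖ ≤ ‖f s‖ + ‖f s - (2 : ℝ) • f (2⁻¹ * s)‖ := by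
      have := norm_sub_le (f s) (f s - (2 : ℝ) • f (2⁻¹ * s))
      rwa [sub_sub_cancel] at this
    rw [norm_smul, Real.norm_two] at h3
    have h4 : 4 * C * ‖f (2⁻¹ * s)‖ ^ 2 ≤ 1 / 3 * ‖f (2⁻¹ * s)‖ := by
      rw [pow_two, ← mul_assoc]
      gcongr
    linarith
  set T : Multiplicative ℝ →* Multiplicative ℝ :=
    AddMonoidHom.toMultiplicative (AddMonoidHom.mulLeft (2⁻¹ : ℝ)) with hT
  have hTn : ∀ (s : ℝ) (k : ℕ), T^[k] (Multiplicative.ofAdd s) =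
      Multiplicative.ofAdd ((2⁻¹ : ℝ) ^ k * s) := by
    intro s k
    induction k with
    | zero => simp
    | succ k ih =>
      rw [Function.iterate_succ_apply', ih, pow_succ', mul_assoc]
      rfl
  obtain ⟨χ, hχadd, hχc, C', hC'⟩ := exists_hom_of_quadratic_error T
    (fun s => f s.toAdd) (fun s => ‖f s.toAdd‖)
    (S := Multiplicative.toAdd ⁻¹' Metric.ball (0 : ℝ) ε) (l := 1 / 2) (m := 3 / 5) (C := 4 * C)
    (Metric.ball_mem_nhds (0 : ℝ) hε) (by norm_num) (by norm_num) (by norm_num) (by positivity)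
    (fun s hs => hhalf _ hs)
    (fun s => by
      have h : Tendsto (fun k : ℕ => (2⁻¹ : ℝ) ^ k * s.toAdd) atTop (𝓝 0) := by
        simpa using (tendsto_pow_atTop_nhds_zero_of_lt_one (r := (2⁻¹ : ℝ)) (by norm_num)
          (by norm_num)).mul_const s.toAdd
      have h' := (continuous_ofAdd.tendsto (0 : ℝ)).comp h
      refine h'.congr fun k => ?_
      exact (hTn s.toAdd k).symm)
    (fun s => norm_nonneg _) (fun s hs => hcontr _ hs)
    (fun s hs => by
      have h1 : ‖f s.toAdd - (2 : ℝ) • f (2⁻¹ * s.toAdd)‖ ≤ 4 * C * ‖f (2⁻¹ * s.toAdd)‖ ^ 2 :=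
        hdouble _ hs
      have h2 : ‖f (2⁻¹ * s.toAdd)‖ ≤ 3 / 5 * ‖f s.toAdd‖ := hcontr _ hs
      have e : f (2⁻¹ * s.toAdd) - (1 / 2 : ℝ) • f s.toAdd =
          (-(1 / 2) : ℝ) • (f s.toAdd - (2 : ℝ) • f (2⁻¹ * s.toAdd)) := by
        rw [smul_sub, smul_smul]
        norm_num
        abel
      have e' : f (T s).toAdd = f (2⁻¹ * s.toAdd) := rfl
      rw [e', e, norm_smul]
      have h3 : ‖f (2⁻¹ * s.toAdd)‖ ^ 2 ≤ ‖f s.toAdd‖ ^ 2 := by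
        gcongr
        linarith [norm_nonneg (f s.toAdd)]
      have h4 : ‖(-(1 / 2) : ℝ)‖ ≤ 1 := by norm_num
      calc _ ≤ 1 * ‖f s.toAdd - (2 : ℝ) • f (2⁻¹ * s.toAdd)‖ := by gcongr
        _ ≤ 4 * C * ‖f (2⁻¹ * s.toAdd)‖ ^ 2 := by rw [one_mul]; exact h1
        _ ≤ _ := by gcongr)
    (fun s hs t ht => by
      exact (hPQ (hball _ hs).1 (hball _ ht).2.1).trans
        (mul_le_mul_of_nonneg_right (by linarith) (sq_nonneg _)))
    hf0 hr0
  set χ' : ℝ →+ EuclideanSpace ℝ (Fin n) := AddMonoidHom.mk' (fun s => χ (Multiplicative.ofAdd s))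
    fun s t => hχadd _ _ with hχ'
  have hχ'c : Continuous χ' := hχc.comp continuous_ofAdd
  have hlin : ∀ s : ℝ, χ' s = s • χ' 1 := fun s => by
    have := map_real_smul χ' hχ'c s 1
    rwa [smul_eq_mul, mul_one] at this
  set X := χ' 1 with hX
  have hC'1 : ∀ s ∈ Metric.ball (0 : ℝ) ε, ‖f s - s • X‖ ≤ |C'| * ‖f s‖ ^ 2 := by
    intro s hs
    rw [← hlin, norm_sub_rev]
    exact (hC' (Multiplicative.ofAdd s) hs).trans
      (mul_le_mul_of_nonneg_right (le_abs_self _) (sq_nonneg _))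
  refine ⟨X, ?_⟩
  have hsmall' : ∀ᶠ s in 𝓝 (0 : ℝ), |C'| * ‖f s‖ ≤ 1 / 2 := by
    have : Tendsto (fun s => |C'| * ‖f s‖) (𝓝 0) (𝓝 0) := by simpa using hr0.const_mul |C'|
    exact (this.eventually (gt_mem_nhds (by norm_num : (0 : ℝ) < 1 / 2))).mono fun s hs => hs.le
  -- The error is quadratic in ‖f s‖. Absorbing half of ‖f s‖ gives ‖f s‖ ≤ 2‖X‖|s|, which makes it
  -- quadratic in s.
  have hbig : (fun s => f s - s • X) =O[𝓝 0] fun s : ℝ => s ^ 2 := by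
    refine Asymptotics.IsBigO.of_bound (|C'| * (2 * ‖X‖) ^ 2) ?_
    filter_upwards [hsmall', Metric.ball_mem_nhds (0 : ℝ) hε] with s hs1 hs2
    have h1 := hC'1 s hs2
    have h2 : |C'| * ‖f s‖ ^ 2 ≤ 1 / 2 * ‖f s‖ := by
      rw [pow_two, ← mul_assoc]
      gcongr
    have h3 : ‖f s‖ ≤ ‖f s - s • X‖ + ‖s • X‖ := by
      simpa using norm_add_le (f s - s • X) (s • X)
    rw [norm_smul] at h3
    have h4 : ‖f s‖ ≤ 2 * ‖X‖ * ‖s‖ := by linarith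
    calc _ ≤ _ := h1
      _ ≤ |C'| * (2 * ‖X‖ * ‖s‖) ^ 2 := by gcongr
      _ = _ := by rw [norm_pow]; ring
  rw [hasDerivAt_iff_isLittleO]
  have hf00 : f 0 = 0 := by simp [hf, hγ0]
  simp only [sub_zero, hf00]
  exact hbig.trans_isLittleO (by
    simpa using (Asymptotics.isLittleO_pow_pow (𝕜 := ℝ) (m := 1) (n := 2) (by norm_num)))

/-- A one-parameter subgroup of a Lie group, written to the left of its value at a point, is
strictly differentiable. -/
theorem hasStrictDerivAt_coord {γ : ℝ → N} (hγ : Continuous γ)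
    (hadd : ∀ s t, γ (s + t) = γ s * γ t) {X : EuclideanSpace ℝ (Fin n)}
    (hX : HasDerivAt (fun s => coord n (γ s)) X 0) (t : ℝ) :
    HasStrictDerivAt (fun s => coord n ((γ t)⁻¹ * γ s)) X t := by
  have hγ0 := map_zero_of_map_add hadd
  have hγt : Tendsto γ (𝓝 0) (𝓝 1) := hγ0 ▸ hγ.tendsto 0
  set M : EuclideanSpace ℝ (Fin n) × EuclideanSpace ℝ (Fin n) → EuclideanSpace ℝ (Fin n) :=
    fun p => coord n (pt n N p.1 * pt n N p.2) with hMdef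
  have hM : ContDiffAt ℝ ∞ M 0 := contDiffAt_mul
  have h0 : coord n (γ 0) = 0 := by rw [hγ0, coord_one]
  have tcoord : Tendsto (fun s => (coord n (γ s), (0 : EuclideanSpace ℝ (Fin n)))) (𝓝 0)
      (𝓝 (0, 0)) := (tendsto_coord.comp hγt).prodMk_nhds tendsto_const_nhds
  have hpt := hγt.eventually (eventually_pt_coord (n := n))
  -- Writing γ(h) = γ(s) γ(h - s) gives the derivative at every s near 0; its continuity at 0 yields
  -- strict differentiability there, and translation carries it to t.
  have hd : ∀ᶠ s in 𝓝 (0 : ℝ), HasDerivAt (fun s => coord n (γ s))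
      (fderiv ℝ M (coord n (γ s), 0) (0, X)) s := by
    filter_upwards [hpt, tcoord.eventually ((hM.of_le (m := 1) (by norm_cast)).eventually
      (by simp))] with s hs1 hs2
    have h1 : HasDerivAt (fun h => M (coord n (γ s), coord n (γ (h - s))))
        (fderiv ℝ M (coord n (γ s), 0) (0, X)) s := by
      have h2 : HasDerivAt (fun h => (coord n (γ s), coord n (γ (h - s)))) (0, X) s := by
        refine (hasDerivAt_const _ _).prodMk ?_
        refine HasDerivAt.comp_sub_const (f := fun h => coord n (γ h)) s s ?_
        rwa [sub_self]
      refine HasFDerivAt.comp_hasDerivAt (l := M) s ?_ h2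
      rw [sub_self, h0]
      exact (hs2.differentiableAt (by simp)).hasFDerivAt
    refine h1.congr_of_eventuallyEq ?_
    have ht : Tendsto (fun h => γ (h - s)) (𝓝 s) (𝓝 1) := by
      refine hγt.comp ?_
      simpa using (continuous_sub_right s).tendsto s
    filter_upwards [ht.eventually (eventually_pt_coord (n := n))] with h hh
    simp only [hMdef, hs1, hh]
    rw [← hadd, add_sub_cancel]
  have hcont : ContinuousAt (fun s => fderiv ℝ M (coord n (γ s), 0) (0, X)) 0 := by
    have h1 : ContinuousAt (fderiv ℝ M) (coord n (γ 0), 0) := by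
      rw [h0]
      exact (hM.fderiv_right (m := 1) (by norm_cast)).continuousAt
    have h2 : ContinuousAt (fun s => (coord n (γ s), (0 : EuclideanSpace ℝ (Fin n)))) 0 := by
      rw [ContinuousAt, h0]
      exact tcoord
    exact (ContinuousAt.comp (g := fderiv ℝ M)
      (f := fun s => (coord n (γ s), (0 : EuclideanSpace ℝ (Fin n)))) h1 h2).clm_apply continuousAt_const
  have hstrict := hasStrictDerivAt_of_hasDerivAt_of_continuousAt hd hcont
  have e : fderiv ℝ M (coord n (γ 0), 0) (0, X) = X := hd.self_of_nhds.unique hX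
  rw [e] at hstrict
  have h3 : (fun s => coord n ((γ t)⁻¹ * γ s)) = fun s => coord n (γ (s - t)) := by
    funext s
    congr 1
    rw [inv_mul_eq_iff_eq_mul, ← hadd, add_sub_cancel]
  rw [h3]
  have h4 := HasStrictDerivAt.scomp t (g₁ := fun s => coord n (γ s)) (h := fun s => s - t)
    (by rw [sub_self]; exact hstrict) ((hasStrictDerivAt_id t).sub_const t)
  simpa [Function.comp_def] using h4

variable [IsTopologicalGroup N]

/-- The adjoint action along a one-parameter subgroup is an exponential. -/
theorem exists_Ad_eq_exp {γ : ℝ → N} (hγ : Continuous γ)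
    (hadd : ∀ s t, γ (s + t) = γ s * γ t) {X : EuclideanSpace ℝ (Fin n)}
    (hX : HasDerivAt (fun s => coord n (γ s)) X 0) :
    ∃ B : EuclideanSpace ℝ (Fin n) →L[ℝ] EuclideanSpace ℝ (Fin n),
      (∀ s, Ad n (γ s) = NormedSpace.exp (s • B)) ∧ HasDerivAt (fun s => Ad n (γ s)) B 0 ∧
      ∀ Y : GroupLieAlgebra (𝓡 n) N,
        B Y = Bracket.bracket (L := GroupLieAlgebra (𝓡 n) N) (M := GroupLieAlgebra (𝓡 n) N) X Y := by
  have hγ0 := map_zero_of_map_add hadd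
  have hγt : Tendsto γ (𝓝 0) (𝓝 1) := hγ0 ▸ hγ.tendsto 0
  obtain ⟨D, hD, hD'⟩ := hasFDerivAt_Ad_pt (n := n) (N := N)
  have h1 : HasDerivAt (fun s => Ad n (γ s)) (D X) 0 := by
    have h2 := HasFDerivAt.comp_hasDerivAt (l := fun u => Ad n (pt n N u)) (0 : ℝ)
      (by rw [hγ0, coord_one]; exact hD) hX
    refine h2.congr_of_eventuallyEq ?_
    filter_upwards [hγt.eventually (eventually_pt_coord (n := n))] with s hs
    simp [hs]
  refine ⟨D X, ?_, h1, fun Y => hD' X Y⟩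
  exact eq_exp_of_hasDerivAt_zero (by rw [hγ0, Ad_one]) (fun s t => by rw [hadd, Ad_mul]) h1

end LieCoord

/-! ### The differential of a word product and its rank -/

namespace LieCoord

open Filter Topology

variable {n : ℕ} {N : Type*} [Group N] [TopologicalSpace N]
  [ChartedSpace (EuclideanSpace ℝ (Fin n)) N] {ι : Type*}

/-- The restriction to the coordinates of positive index. -/
noncomputable def tailCLM (K : ℕ) : (Fin (K + 1) → ℝ) →L[ℝ] (Fin K → ℝ) :=
  ContinuousLinearMap.pi fun i => ContinuousLinearMap.proj i.succ

/-- The derivative of `wordProduct` at `t`, translated to the identity from the left. -/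
noncomputable def wordDeriv (γ : ι → ℝ → N) (X : ι → EuclideanSpace ℝ (Fin n)) :
    (K : ℕ) → (Fin K → ι) → (Fin K → ℝ) → ((Fin K → ℝ) →L[ℝ] EuclideanSpace ℝ (Fin n))
  | 0, _, _ => 0
  | K + 1, w, t => (Ad n (γ (w 0) (t 0))⁻¹).comp
      ((wordDeriv γ X K (Fin.tail w) (Fin.tail t)).comp (tailCLM K)) +
      (ContinuousLinearMap.proj 0 : (Fin (K + 1) → ℝ) →L[ℝ] ℝ).smulRight (X (w 0))

theorem wordDeriv_succ_apply (γ : ι → ℝ → N) (X : ι → EuclideanSpace ℝ (Fin n)) {K : ℕ}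
    (w : Fin (K + 1) → ι) (t v : Fin (K + 1) → ℝ) :
    wordDeriv γ X (K + 1) w t v = Ad n (γ (w 0) (t 0))⁻¹
      (wordDeriv γ X K (Fin.tail w) (Fin.tail t) (Fin.tail v)) + v 0 • X (w 0) := rfl

/-- The parameters enter only through operators Ad(γ(t_0))⁻¹ = exp(-t_0 B), which are analytic
although the group is only assumed smooth. -/
theorem analyticAt_wordDeriv_apply {γ : ι → ℝ → N}
    (hadd : ∀ i s t, γ i (s + t) = γ i s * γ i t) {X : ι → EuclideanSpace ℝ (Fin n)}
    {B : ι → EuclideanSpace ℝ (Fin n) →L[ℝ] EuclideanSpace ℝ (Fin n)}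
    (hB : ∀ i s, Ad n (γ i s) = NormedSpace.exp (s • B i)) :
    ∀ (K : ℕ) (w : Fin K → ι) (v t : Fin K → ℝ),
      AnalyticAt ℝ (fun t => wordDeriv γ X K w t v) t
  | 0, w, v, t => analyticAt_const
  | K + 1, w, v, t => by
    have h1 : AnalyticAt ℝ (fun t : Fin (K + 1) → ℝ => Ad n (γ (w 0) (t 0))⁻¹) t := by
      have e : (fun t : Fin (K + 1) → ℝ => Ad n (γ (w 0) (t 0))⁻¹) =
          fun t => NormedSpace.exp ((-(ContinuousLinearMap.proj 0 :
            (Fin (K + 1) → ℝ) →L[ℝ] ℝ) t) • B (w 0)) := by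
        funext t
        rw [← hB]
        congr 1
        rw [inv_eq_iff_mul_eq_one, ← hadd]
        simpa using map_zero_of_map_add (hadd (w 0))
      rw [e]
      refine AnalyticAt.comp (NormedSpace.exp_analytic (𝕂 := ℝ) _) ?_
      exact ((ContinuousLinearMap.proj 0 : (Fin (K + 1) → ℝ) →L[ℝ] ℝ).analyticAt t).neg.smul
        analyticAt_const
    have h2 : AnalyticAt ℝ (fun t : Fin (K + 1) → ℝ =>
        wordDeriv γ X K (Fin.tail w) (tailCLM K t) (Fin.tail v)) t :=
      AnalyticAt.comp (analyticAt_wordDeriv_apply hadd hB K (Fin.tail w) (Fin.tail v) (tailCLM K t))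
        ((tailCLM K).analyticAt t)
    exact (AnalyticAt.comp (ContinuousLinearMap.analyticAt_bilinear (ContinuousLinearMap.id ℝ
      (EuclideanSpace ℝ (Fin n) →L[ℝ] EuclideanSpace ℝ (Fin n))) _) (h1.prod h2)).add
      analyticAt_const

/-- If the product of a word is regular at some point, then it is regular almost everywhere. -/
theorem ae_surjective_wordDeriv {γ : ι → ℝ → N}
    (hadd : ∀ i s t, γ i (s + t) = γ i s * γ i t) {X : ι → EuclideanSpace ℝ (Fin n)}
    {B : ι → EuclideanSpace ℝ (Fin n) →L[ℝ] EuclideanSpace ℝ (Fin n)}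
    (hB : ∀ i s, Ad n (γ i s) = NormedSpace.exp (s • B i)) {K : ℕ} {w : Fin K → ι}
    {t₀ : Fin K → ℝ} (h : Function.Surjective (wordDeriv γ X K w t₀)) :
    ∀ᵐ t, Function.Surjective (wordDeriv γ X K w t) := by
  -- Preimages of the basis vectors under the differential at t₀ are kept fixed while t varies. The
  -- resulting square matrix is 1 at t₀, its determinant is analytic, and where it is nonzero the
  -- differential is onto.
  choose R hR using fun j => h (EuclideanSpace.single j (1 : ℝ))
  set A : (Fin K → ℝ) → Matrix (Fin n) (Fin n) ℝ :=
    fun t => Matrix.of fun i j => wordDeriv γ X K w t (R j) i with hA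
  have hana : AnalyticOnNhd ℝ (fun t => (A t).det) Set.univ := by
    intro t _
    simp only [Matrix.det_apply']
    refine Finset.analyticAt_fun_sum _ fun σ _ => ?_
    refine analyticAt_const.mul ?_
    refine Finset.analyticAt_fun_prod _ fun i _ => ?_
    exact AnalyticAt.comp (g := fun v : EuclideanSpace ℝ (Fin n) => v (σ i))
      ((EuclideanSpace.proj (𝕜 := ℝ) (σ i)).analyticAt _)
      (analyticAt_wordDeriv_apply hadd hB K w (R i) t)
  have h0 : (A t₀).det ≠ 0 := by
    have : A t₀ = 1 := by
      ext i j
      simp [hA, hR, Matrix.one_apply]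
    rw [this, Matrix.det_one]
    exact one_ne_zero
  refine (ae_ne_zero_of_analyticOnNhd K _ hana t₀ h0).mono fun t ht y => ?_
  have hy : (A t).mulVec ((A t)⁻¹.mulVec y) = y := by
    rw [Matrix.mulVec_mulVec, Matrix.mul_nonsing_inv _ (Ne.isUnit ht), Matrix.one_mulVec]
  refine ⟨∑ j, ((A t)⁻¹.mulVec y) j • R j, ?_⟩
  ext i
  rw [map_sum]
  conv_rhs => rw [← hy]
  simp [Matrix.mulVec, dotProduct, hA, mul_comm]

variable [LieGroup (𝓡 n) ∞ N] [IsTopologicalGroup N]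

/-- The recursion of `wordDeriv` is the product rule `hasStrictFDerivAt_log_mul`, with the rightmost
letter as second factor. -/
theorem hasStrictFDerivAt_wordProduct {γ : ι → ℝ → N} (hγ : ∀ i, Continuous (γ i))
    (hadd : ∀ i s t, γ i (s + t) = γ i s * γ i t) {X : ι → EuclideanSpace ℝ (Fin n)}
    (hX : ∀ i, HasDerivAt (fun s => coord n (γ i s)) (X i) 0) :
    ∀ (K : ℕ) (w : Fin K → ι) (t : Fin K → ℝ),
      HasStrictFDerivAt (fun s => coord n ((wordProduct γ K w t)⁻¹ * wordProduct γ K w s))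
        (wordDeriv γ X K w t) t
  | 0, w, t => by
    simpa [wordProduct, wordDeriv] using hasStrictFDerivAt_const (0 : EuclideanSpace ℝ (Fin n)) t
  | K + 1, w, t => by
    have h1 : HasStrictFDerivAt (fun s => coord n ((wordProduct γ K (Fin.tail w) (tailCLM K t))⁻¹ *
        wordProduct γ K (Fin.tail w) (tailCLM K s)))
        ((wordDeriv γ X K (Fin.tail w) (Fin.tail t)).comp (tailCLM K)) t :=
      HasStrictFDerivAt.comp t (hasStrictFDerivAt_wordProduct hγ hadd hX K (Fin.tail w)
        (tailCLM K t)) (tailCLM K).hasStrictFDerivAt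
    have h2 : HasStrictFDerivAt (fun s : Fin (K + 1) → ℝ =>
        coord n ((γ (w 0) (t 0))⁻¹ * γ (w 0) (s 0)))
        ((ContinuousLinearMap.proj 0 : (Fin (K + 1) → ℝ) →L[ℝ] ℝ).smulRight (X (w 0))) t := by
      have h3 := (hasStrictDerivAt_coord (hγ (w 0)) (hadd (w 0)) (hX (w 0)) (t 0)).hasStrictFDerivAt
      have h4 := HasStrictFDerivAt.comp t
        (g := fun s => coord n ((γ (w 0) (t 0))⁻¹ * γ (w 0) s))
        (f := fun s : Fin (K + 1) → ℝ => s 0) h3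
        (ContinuousLinearMap.proj 0 : (Fin (K + 1) → ℝ) →L[ℝ] ℝ).hasStrictFDerivAt
      have e : (ContinuousLinearMap.proj 0 : (Fin (K + 1) → ℝ) →L[ℝ] ℝ).smulRight (X (w 0)) =
          (ContinuousLinearMap.toSpanSingleton ℝ (X (w 0))).comp (ContinuousLinearMap.proj 0) :=
        ContinuousLinearMap.ext fun v => rfl
      rw [e]
      exact h4
    exact hasStrictFDerivAt_log_mul
      (g := fun s => wordProduct γ K (Fin.tail w) (tailCLM K s))
      (h := fun s : Fin (K + 1) → ℝ => γ (w 0) (s 0))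
      ((continuous_wordProduct hγ K _).comp (tailCLM K).continuous).continuousAt
      ((hγ (w 0)).comp (continuous_apply 0)).continuousAt h1 h2

theorem Ad_inv_apply_Ad_apply (g : N) (u : EuclideanSpace ℝ (Fin n)) :
    Ad n g⁻¹ (Ad n g u) = u := by
  have h := Ad_mul (n := n) g⁻¹ g
  rw [inv_mul_cancel, Ad_one] at h
  exact (DFunLike.congr_fun h u).symm

theorem Ad_apply_Ad_inv_apply (g : N) (u : EuclideanSpace ℝ (Fin n)) :
    Ad n g (Ad n g⁻¹ u) = u := by
  simpa using Ad_inv_apply_Ad_apply g⁻¹ u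

/-- Some product of one-parameter subgroups is regular at some point, unless the directions are
contained in a proper subspace stable under the adjoint action. -/
theorem exists_surjective_wordDeriv {γ : ι → ℝ → N} (hadd : ∀ i s t, γ i (s + t) = γ i s * γ i t)
    {X : ι → EuclideanSpace ℝ (Fin n)}
    (hU : ∀ U : Submodule ℝ (EuclideanSpace ℝ (Fin n)), (∀ i, X i ∈ U) →
      (∀ i s, ∀ u ∈ U, Ad n (γ i s) u ∈ U) → U = ⊤) :
    ∃ (K : ℕ) (w : Fin K → ι) (t : Fin K → ℝ), Function.Surjective (wordDeriv γ X K w t) := by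
  set R : (Σ K : ℕ, (Fin K → ι) × (Fin K → ℝ)) → Submodule ℝ (EuclideanSpace ℝ (Fin n)) :=
    fun p => (wordDeriv γ X p.1 p.2.1 p.2.2).range with hR
  set r : ℕ := sSup (Set.range fun p => Module.finrank ℝ (R p)) with hr
  have hbdd : BddAbove (Set.range fun p => Module.finrank ℝ (R p)) :=
    ⟨Module.finrank ℝ (EuclideanSpace ℝ (Fin n)), by
      rintro _ ⟨p, rfl⟩
      exact Submodule.finrank_le _⟩
  have hle : ∀ p, Module.finrank ℝ (R p) ≤ r := fun p => le_csSup hbdd ⟨p, rfl⟩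
  have hmem : r ∈ Set.range fun p => Module.finrank ℝ (R p) :=
    Nat.sSup_mem ⟨_, Set.mem_range_self ⟨0, Fin.elim0, Fin.elim0⟩⟩ hbdd
  obtain ⟨p₀, hp₀⟩ := hmem
  -- Appending the letter i with parameter s gives a range containing both X i and Ad(γ i s)⁻¹(R p).
  -- The latter already has the maximal dimension r, so the two ranges coincide.
  have hstep : ∀ p, Module.finrank ℝ (R p) = r → ∀ i s, ∃ q, Module.finrank ℝ (R q) = r ∧
      X i ∈ R q ∧ R q = (R p).map (Ad n (γ i s)⁻¹ : _ →ₗ[ℝ] EuclideanSpace ℝ (Fin n)) := by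
    rintro ⟨K, w, t⟩ hp i s
    set q : Σ K : ℕ, (Fin K → ι) × (Fin K → ℝ) := ⟨K + 1, Fin.cons i w, Fin.cons s t⟩ with hq
    have hinj : Function.Injective (Ad n (γ i s)⁻¹ : _ →ₗ[ℝ] EuclideanSpace ℝ (Fin n)) :=
      Function.LeftInverse.injective (g := Ad n (γ i s)) fun u => Ad_apply_Ad_inv_apply _ _
    have hmap : (R ⟨K, w, t⟩).map (Ad n (γ i s)⁻¹ : _ →ₗ[ℝ] EuclideanSpace ℝ (Fin n)) ≤ R q := by
      rintro _ ⟨_, ⟨v, rfl⟩, rfl⟩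
      refine ⟨Fin.cons 0 v, ?_⟩
      change wordDeriv γ X (K + 1) (Fin.cons i w) (Fin.cons s t) (Fin.cons 0 v) = _
      rw [wordDeriv_succ_apply]
      simp
    have hX : X i ∈ R q := by
      refine ⟨Fin.cons 1 0, ?_⟩
      change wordDeriv γ X (K + 1) (Fin.cons i w) (Fin.cons s t) (Fin.cons 1 0) = _
      rw [wordDeriv_succ_apply]
      simp
    have hfin : Module.finrank ℝ ((R ⟨K, w, t⟩).map
        (Ad n (γ i s)⁻¹ : _ →ₗ[ℝ] EuclideanSpace ℝ (Fin n))) = r :=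
      (Submodule.equivMapOfInjective _ hinj _).finrank_eq.symm.trans hp
    have hqr : Module.finrank ℝ (R q) = r :=
      le_antisymm (hle q) (hfin ▸ Submodule.finrank_mono hmap)
    exact ⟨q, hqr, hX, (Submodule.eq_of_le_of_finrank_eq hmap (hfin.trans hqr.symm)).symm⟩
  -- Taking s = 0 in `hstep` puts every X i in every maximal range. For general s, a vector of U
  -- lies in Ad(γ i s)⁻¹(R p), so Ad(γ i s) maps it into R p, for each maximal p.
  set U : Submodule ℝ (EuclideanSpace ℝ (Fin n)) :=
    ⨅ p : {p // Module.finrank ℝ (R p) = r}, R p with hUdef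
  have hUtop : U = ⊤ := by
    refine hU U (fun i => ?_) fun i s u hu => ?_
    · refine (Submodule.mem_iInf _).2 fun p => ?_
      obtain ⟨q, -, hXq, hq⟩ := hstep p p.2 i 0
      rw [map_zero_of_map_add (hadd i), inv_one, Ad_one] at hq
      have e : R q = R p := hq.trans (Submodule.map_id _)
      rwa [e] at hXq
    · refine (Submodule.mem_iInf _).2 fun p => ?_
      obtain ⟨q, hqr, -, hq⟩ := hstep p p.2 i s
      have huq : u ∈ R q := (Submodule.mem_iInf _).1 hu ⟨q, hqr⟩
      rw [hq] at huq
      obtain ⟨v, hv, rfl⟩ := huq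
      have e : Ad n (γ i s) ((Ad n (γ i s)⁻¹ : _ →ₗ[ℝ] EuclideanSpace ℝ (Fin n)) v) = v :=
        Ad_apply_Ad_inv_apply _ _
      rw [e]
      exact hv
  refine ⟨p₀.1, p₀.2.1, p₀.2.2, LinearMap.range_eq_top.1 ?_⟩
  rw [eq_top_iff, ← hUtop]
  exact iInf_le (fun p : {p // Module.finrank ℝ (R p) = r} => R p) ⟨p₀, hp₀⟩

end LieCoord

/-! ### Null sets of the group and of the parameters; using the stratification -/

namespace LieCoord

open Filter Topology

variable {n : ℕ} {N : Type*} [Group N] [TopologicalSpace N]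
  [ChartedSpace (EuclideanSpace ℝ (Fin n)) N] {ι : Type*}

/-- Continuity on a whole ball allows a measurable extension of `pt` to all of the model space, as
Fubini requires. -/
theorem exists_continuousOn_pt : ∃ ε > 0, ContinuousOn (pt n N) (Metric.ball 0 ε) := by
  obtain ⟨ε, hε, h⟩ := Metric.eventually_nhds_iff_ball.1 (tendsto_add_chart_one.eventually
    (extChartAt_target_mem_nhds (I := 𝓡 n) (1 : N)))
  exact ⟨ε, hε, (continuousOn_extChartAt_symm (I := 𝓡 n) (1 : N)).comp
    (continuous_id.add continuous_const).continuousOn h⟩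

variable [LieGroup (𝓡 n) ∞ N] [IsTopologicalGroup N]

/-- Haar-null sets are Lebesgue-null in the coordinates, near the identity. -/
theorem exists_volume_inter_preimage_pt_eq_zero [SecondCountableTopology N] [MeasurableSpace N]
    [BorelSpace N] (μ : Measure N) [μ.IsHaarMeasure] [SFinite μ] {s : Set N}
    (hs : MeasurableSet s) (h0 : μ s = 0) :
    ∃ U ∈ 𝓝 (0 : EuclideanSpace ℝ (Fin n)), volume (U ∩ pt n N ⁻¹' s) = 0 := by
  classical
  obtain ⟨ε, hε, hpt⟩ := exists_continuousOn_pt (n := n) (N := N)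
  set B := Metric.ball (0 : EuclideanSpace ℝ (Fin n)) ε with hB
  set q : EuclideanSpace ℝ (Fin n) → N := B.piecewise (pt n N) fun _ => 1 with hq
  have hqm : Measurable q :=
    hpt.measurable_piecewise continuousOn_const Metric.isOpen_ball.measurableSet
  have hm : Measurable fun p : N × EuclideanSpace ℝ (Fin n) => p.1 * q p.2 :=
    measurable_fst.mul (hqm.comp measurable_snd)
  -- No density of μ in the chart is computed. For fixed u the slice {g : g q(u) ∈ s} is a right
  -- translate of a null set, so by Fubini almost every left translate of s is Lebesgue-null in the
  -- chart.
  have hprod : (μ.prod (volume.restrict B))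
      ((fun p : N × EuclideanSpace ℝ (Fin n) => p.1 * q p.2) ⁻¹' s) = 0 := by
    rw [← Measure.prod_swap, Measure.map_apply measurable_swap (hm hs),
      Measure.measure_prod_null (measurable_swap (hm hs))]
    exact Eventually.of_forall fun u => (measure_mul_right_null μ (q u)).2 h0
  rw [Measure.measure_prod_null (hm hs)] at hprod
  have hgood : ∀ᵐ g ∂μ, volume {u | u ∈ B ∧ g * pt n N u ∈ s} = 0 := by
    filter_upwards [hprod] with g hg
    rw [Pi.zero_apply, Measure.restrict_apply' Metric.isOpen_ball.measurableSet] at hg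
    refine measure_mono_null ?_ hg
    rintro u ⟨hu1, hu2⟩
    refine ⟨?_, hu1⟩
    change g * q u ∈ s
    rw [hq, Set.piecewise_eq_of_mem _ _ _ hu1]
    exact hu2
  have hM : ∀ᶠ p in 𝓝 (0 : EuclideanSpace ℝ (Fin n) × EuclideanSpace ℝ (Fin n)),
      DifferentiableAt ℝ (fun p : EuclideanSpace ℝ (Fin n) × EuclideanSpace ℝ (Fin n) =>
        coord n (pt n N p.1 * pt n N p.2)) p := by
    filter_upwards [((contDiffAt_mul (n := n) (N := N)).of_le (m := 1) (by norm_cast)).eventually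
      (by simp)] with p hp
    exact hp.differentiableAt (by simp)
  have t1 : Tendsto (fun p : N × EuclideanSpace ℝ (Fin n) => p.1⁻¹ * pt n N p.2)
      (𝓝 1 ×ˢ 𝓝 0) (𝓝 1) := by
    simpa using (tendsto_fst (f := 𝓝 (1 : N)) (g := 𝓝 (0 : EuclideanSpace ℝ (Fin n)))).inv.mul
      ((tendsto_pt (n := n) (N := N)).comp tendsto_snd)
  have t2 : Tendsto (fun p : N × EuclideanSpace ℝ (Fin n) => coord n (p.1⁻¹ * pt n N p.2))
      (𝓝 1 ×ˢ 𝓝 0) (𝓝 0) := tendsto_coord.comp t1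
  have t3 : Tendsto (fun p : N × EuclideanSpace ℝ (Fin n) => coord n p.1)
      (𝓝 1 ×ˢ 𝓝 0) (𝓝 0) := tendsto_coord.comp tendsto_fst
  have hev : ∀ᶠ p : N × EuclideanSpace ℝ (Fin n) in 𝓝 1 ×ˢ 𝓝 0,
      pt n N (coord n (p.1⁻¹ * pt n N p.2)) = p.1⁻¹ * pt n N p.2 ∧
      coord n (p.1⁻¹ * pt n N p.2) ∈ B ∧ coord n (pt n N p.2) = p.2 ∧
      DifferentiableAt ℝ (fun u => coord n (p.1 * pt n N u)) (coord n (p.1⁻¹ * pt n N p.2)) := by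
    filter_upwards [t1.eventually (eventually_pt_coord (n := n)),
      t2.eventually (Metric.ball_mem_nhds 0 hε),
      tendsto_snd.eventually (eventually_coord_pt (n := n) (N := N)),
      tendsto_fst.eventually (eventually_pt_coord (n := n) (N := N)),
      (t3.prodMk_nhds t2).eventually hM] with p h1 h2 h3 h4 h5
    refine ⟨h1, h2, h3, ?_⟩
    have h6 := DifferentiableAt.comp (coord n (p.1⁻¹ * pt n N p.2))
      (f := fun u => (coord n p.1, u)) h5 (differentiableAt_const _ |>.prodMk differentiableAt_id)
    simpa [Function.comp_def, h4] using h6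
  obtain ⟨P, hP, Q, hQ, hPQ⟩ := eventually_prod_iff.1 hev
  -- μ charges open sets, so a good g exists arbitrarily near 1. Left multiplication by it is
  -- differentiable in coordinates and carries the null set for g⁻¹s onto the one for s.
  obtain ⟨g, hg, hgP⟩ := (Measure.dense_of_ae hgood).inter_nhds_nonempty hP
  refine ⟨{v | Q v}, hQ, ?_⟩
  have himg := addHaar_image_eq_zero_of_differentiableOn_of_addHaar_eq_zero
    (f := fun u => coord n (g * pt n N u))
    (s := {u | (u ∈ B ∧ g * pt n N u ∈ s) ∧ DifferentiableAt ℝ (fun u => coord n (g * pt n N u)) u})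
    volume (fun u hu => hu.2.differentiableWithinAt) (measure_mono_null (fun u hu => hu.1) hg)
  refine measure_mono_null ?_ himg
  rintro v ⟨hvQ, hvs⟩
  obtain ⟨h1, h2, h3, h4⟩ := hPQ hgP hvQ
  refine ⟨coord n (g⁻¹ * pt n N v), ⟨⟨h2, ?_⟩, h4⟩, ?_⟩
  · rw [h1, mul_inv_cancel_left]
    exact hvs
  · dsimp only at h1 h3 ⊢
    rw [h1, mul_inv_cancel_left, h3]

/-- If the product of a word is regular somewhere, then it pulls Haar-null sets back to null
sets. -/
theorem volume_preimage_wordProduct_eq_zero [SecondCountableTopology N] [MeasurableSpace N]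
    [BorelSpace N] (μ : Measure N) [μ.IsHaarMeasure] [SFinite μ] {γ : ι → ℝ → N}
    (hγ : ∀ i, Continuous (γ i)) (hadd : ∀ i s t, γ i (s + t) = γ i s * γ i t)
    {X : ι → EuclideanSpace ℝ (Fin n)} (hX : ∀ i, HasDerivAt (fun s => coord n (γ i s)) (X i) 0)
    {K : ℕ} {w : Fin K → ι} {t₀ : Fin K → ℝ} (h : Function.Surjective (wordDeriv γ X K w t₀))
    {s : Set N} (hs : MeasurableSet s) (h0 : μ s = 0) :
    volume {t | wordProduct γ K w t ∈ s} = 0 := by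
  choose B hB using fun i => exists_Ad_eq_exp (n := n) (N := N) (hγ i) (hadd i) (hX i)
  have hreg := ae_surjective_wordDeriv (X := X) hadd (fun i => (hB i).1) h
  have hloc : volume {t | wordProduct γ K w t ∈ s ∧
      Function.Surjective (wordDeriv γ X K w t)} = 0 := by
    refine measure_null_of_locally_null _ fun t ht => ?_
    have hs' : MeasurableSet ((fun x => wordProduct γ K w t * x) ⁻¹' s) :=
      (continuous_const.mul continuous_id).measurable hs
    obtain ⟨U, hU, hU0⟩ := exists_volume_inter_preimage_pt_eq_zero (n := n) μ hs'
      (by rwa [measure_preimage_mul])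
    obtain ⟨U', hU', hU'0⟩ := (hasStrictFDerivAt_wordProduct hγ hadd hX K w
      t).exists_measure_inter_preimage_eq_zero volume volume ht.2 hU0
    have h1 : Tendsto (fun r => (wordProduct γ K w t)⁻¹ * wordProduct γ K w r) (𝓝 t) (𝓝 1) := by
      simpa using ((continuous_wordProduct hγ K w).tendsto t).const_mul (wordProduct γ K w t)⁻¹
    have h2 : {r | wordProduct γ K w r ∈ s} ∩ {t | Function.Surjective (wordDeriv γ X K w t)} ∩
        {r | r ∈ U' ∧ pt n N (coord n ((wordProduct γ K w t)⁻¹ * wordProduct γ K w r)) =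
          (wordProduct γ K w t)⁻¹ * wordProduct γ K w r ∧
          coord n ((wordProduct γ K w t)⁻¹ * wordProduct γ K w r) ∈ U} ∈
        𝓝[{t | wordProduct γ K w t ∈ s ∧ Function.Surjective (wordDeriv γ X K w t)}] t := by
      refine inter_mem_nhdsWithin _ ?_
      filter_upwards [hU', h1.eventually (eventually_pt_coord (n := n)),
        (tendsto_coord.comp h1).eventually hU] with r h3 h4 h5
      exact ⟨h3, h4, h5⟩
    refine ⟨_, h2, measure_mono_null ?_ hU'0⟩
    rintro r ⟨⟨hr, -⟩, h3, h4, h5⟩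
    refine ⟨h3, h5, ?_⟩
    change wordProduct γ K w t * pt n N (coord n _) ∈ s
    rw [h4, mul_inv_cancel_left]
    exact hr
  refine measure_mono_null (fun t ht => ?_) (measure_union_null hloc (ae_iff.1 hreg))
  by_cases h : Function.Surjective (wordDeriv γ X K w t)
  · exact Or.inl ⟨ht, h⟩
  · exact Or.inr h

/-- A subspace stable under the adjoint action of one-parameter subgroups whose directions it
contains, and whose directions span the first layer of a stratification, is everything. -/
theorem eq_top_of_stratification {γ : ι → ℝ → N} (hγ : ∀ i, Continuous (γ i))
    (hadd : ∀ i s t, γ i (s + t) = γ i s * γ i t) {X : ι → EuclideanSpace ℝ (Fin n)}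
    (hX : ∀ i, HasDerivAt (fun s => coord n (γ i s)) (X i) 0)
    {V : ℕ → Submodule ℝ (GroupLieAlgebra (𝓡 n) N)} (hV : IsStratification n N V)
    (hV1 : ∀ x : EuclideanSpace ℝ (Fin n), x ∈ V 1 → x ∈ Submodule.span ℝ (Set.range X))
    (U : Submodule ℝ (EuclideanSpace ℝ (Fin n))) (hUX : ∀ i, X i ∈ U)
    (hU : ∀ i s, ∀ u ∈ U, Ad n (γ i s) u ∈ U) : U = ⊤ := by
  obtain ⟨D, -, hD⟩ := hasFDerivAt_Ad_pt (n := n) (N := N)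
  have hUc : IsClosed (U : Set (EuclideanSpace ℝ (Fin n))) := U.closed_of_finiteDimensional
  -- Differentiate the curve s ↦ Ad(γ i s) y, which stays in the closed subspace U.
  have h1 : ∀ i, ∀ y ∈ U, D (X i) y ∈ U := by
    intro i y hy
    obtain ⟨B, -, hB, hB'⟩ := exists_Ad_eq_exp (hγ i) (hadd i) (hX i)
    have h2 : HasDerivAt (fun s => Ad n (γ i s) y) (B y) 0 := by
      simpa using hB.clm_apply (hasDerivAt_const 0 y)
    have h3 : D (X i) y = B y := (hD (X i) y).trans (hB' y).symm
    rw [h3]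
    have h4 := (hasDerivAt_iff_tendsto_slope.1 h2)
    refine hUc.mem_of_tendsto h4 (Eventually.of_forall fun s => ?_)
    rw [slope_def_module]
    exact U.smul_mem _ (U.sub_mem (hU i s y hy) (hU i 0 y hy))
  have h2 : ∀ x ∈ Submodule.span ℝ (Set.range X), ∀ y ∈ U, D x y ∈ U := by
    intro x hx y hy
    induction hx using Submodule.span_induction with
    | mem x hx => obtain ⟨i, rfl⟩ := hx; exact h1 i y hy
    | zero => simp
    | add x x' _ _ h h' => rw [map_add]; exact U.add_mem h h'
    | smul c x _ h => rw [map_smul]; exact U.smul_mem c h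
  have h3 : ∀ k : ℕ, ∀ x : EuclideanSpace ℝ (Fin n), x ∈ V (k + 1) → x ∈ U := by
    intro k
    induction k with
    | zero =>
      intro x hx
      exact (Submodule.span_le.2 (by rintro _ ⟨i, rfl⟩; exact hUX i) : _ ≤ U) (hV1 x hx)
    | succ k ih =>
      have h4 := hV.bracket (k + 1) (by omega)
      let U' : Submodule ℝ (GroupLieAlgebra (𝓡 n) N) := U
      have h5 : V (k + 1 + 1) ≤ U' := by
        rw [← h4]
        refine Submodule.span_le.2 ?_
        rintro _ ⟨x, hx, y, hy, rfl⟩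
        have h6 : D x y ∈ U := h2 x (hV1 x hx) y (ih y hy)
        rw [hD x y] at h6
        exact h6
      exact fun x hx => h5 hx
  let U' : Submodule ℝ (GroupLieAlgebra (𝓡 n) N) := U
  have h5 : (⊤ : Submodule ℝ (GroupLieAlgebra (𝓡 n) N)) ≤ U' := by
    rw [← hV.isInternal.submodule_iSup_eq_top]
    refine iSup_le fun k => ?_
    cases k with
    | zero => rw [hV.zero]; exact bot_le
    | succ k => exact fun x hx => h3 k x hx
  exact top_le_iff.1 h5

end LieCoord

/-! ### Projection onto the first layer and its integration to a homomorphism -/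

/-- The first layer of a graded family of dilations is the image of a bounded projection that
intertwines the dilations with the scalars. -/
theorem exists_projection_of_dilations {E : Type*} [NormedAddCommGroup E] [NormedSpace ℝ E]
    [FiniteDimensional ℝ E] {V : ℕ → Submodule ℝ E} (h0 : V 0 = ⊥) (hind : iSupIndep V)
    (htop : ⨆ k, V k = ⊤) {D : ℝ → E →L[ℝ] E} (hD : ∀ t k, ∀ x ∈ V k, D t x = t ^ k • x) :
    ∃ P : E →L[ℝ] E, (∀ x ∈ V 1, P x = x) ∧ (∀ x, P x ∈ V 1) ∧ (∀ t x, P (D t x) = t • P x) ∧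
      (∀ x, (∀ t, D t x = t • x) → P x = x) ∧
      ∃ C : ℝ, 1 ≤ C ∧ ∀ t ∈ Set.Ioc (0 : ℝ) 1, ‖D t‖ ≤ C * t := by
  set W : Submodule ℝ E := ⨆ k : {k : ℕ // k ≠ 1}, V k with hW
  have hW' : W = ⨆ k, ⨆ (_ : k ≠ 1), V k := by rw [hW, iSup_subtype]
  have hcompl : IsCompl (V 1) W := by
    refine ⟨hW' ▸ hind 1, codisjoint_iff.2 (top_le_iff.1 ?_)⟩
    rw [← htop]
    refine iSup_le fun k => ?_
    by_cases hk : k = 1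
    · rw [hk]
      exact le_sup_left
    · exact (le_iSup (fun k : {k : ℕ // k ≠ 1} => V k) ⟨k, hk⟩).trans le_sup_right
  set P : E →L[ℝ] E := LinearMap.toContinuousLinearMap ((V 1).projection W hcompl) with hP
  have hP1 : ∀ x ∈ V 1, P x = x := fun x hx => Submodule.projection_apply_of_mem_left hcompl hx
  have hPW : ∀ x ∈ W, P x = 0 := fun x hx => (Submodule.projection_apply_eq_zero_iff hcompl).2 hx
  have hPV : ∀ x, P x ∈ V 1 := fun x => Submodule.projection_apply_mem hcompl x
  have hsub : ∀ x, x - P x ∈ W := fun x => Submodule.sub_projection_mem hcompl x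
  -- W gathers the layers other than V 1. Since V 0 = 0, only degrees at least 2 contribute, so D t
  -- is O(t²) at each vector of W; an eigenvector of weight t therefore has no component there.
  have hDW : ∀ y ∈ W, (∀ t, D t y ∈ W) ∧
      ∃ c : ℝ, ∀ t ∈ Set.Ioc (0 : ℝ) 1, ‖D t y‖ ≤ c * t ^ 2 := by
    intro y hy
    induction hy using Submodule.iSup_induction' with
    | mem k x hx =>
      refine ⟨fun t => ?_, ‖x‖, fun t ht => ?_⟩
      · rw [hD t k x hx]
        exact W.smul_mem _ ((le_iSup (fun k : {k : ℕ // k ≠ 1} => V k) k) hx)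
      · rw [hD t k x hx, norm_smul, mul_comm, norm_pow, Real.norm_of_nonneg ht.1.le]
        obtain ⟨k, hk⟩ := k
        rcases Nat.eq_zero_or_pos k with rfl | hk0
        · have hx0 : x ∈ V 0 := hx
          rw [h0, Submodule.mem_bot] at hx0
          simp [hx0]
        · have hk2 : 2 ≤ k := by omega
          exact mul_le_mul_of_nonneg_left (pow_le_pow_of_le_one ht.1.le ht.2 hk2) (norm_nonneg x)
    | zero => exact ⟨fun t => by simp, 0, fun t _ => by simp⟩
    | add x y _ _ hx hy =>
      obtain ⟨hx1, c, hc⟩ := hx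
      obtain ⟨hy1, c', hc'⟩ := hy
      refine ⟨fun t => ?_, c + c', fun t ht => ?_⟩
      · rw [map_add]
        exact W.add_mem (hx1 t) (hy1 t)
      · rw [map_add, add_mul]
        exact (norm_add_le _ _).trans (add_le_add (hc t ht) (hc' t ht))
  have hdec : ∀ t x, D t x = t • P x + D t (x - P x) := by
    intro t x
    have h := hD t 1 (P x) (hPV x)
    rw [pow_one] at h
    rw [map_sub, h, add_sub_cancel]
  refine ⟨P, hP1, hPV, fun t x => ?_, fun x hx => ?_, ?_⟩
  · rw [hdec, map_add, hPW _ ((hDW _ (hsub x)).1 t), map_smul, hP1 _ (hPV x), add_zero]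
  · obtain ⟨-, c, hc⟩ := hDW _ (hsub x)
    have h1 : ∀ t ∈ Set.Ioc (0 : ℝ) 1, ‖x - P x‖ ≤ c * t := by
      intro t ht
      have h2 : D t (x - P x) = t • (x - P x) := by
        have h3 := hdec t x
        rw [hx] at h3
        rw [smul_sub, h3, add_sub_cancel_left]
      have h4 := hc t ht
      rw [h2, norm_smul, Real.norm_of_nonneg ht.1.le, pow_two, mul_left_comm] at h4
      exact le_of_mul_le_mul_left h4 ht.1
    have h5 : ‖x - P x‖ ≤ 0 := by
      have h6 : Filter.Tendsto (fun t : ℝ => c * t) (nhdsWithin 0 (Set.Ioi 0)) (nhds 0) := by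
        have : Filter.Tendsto (fun t : ℝ => c * t) (nhds 0) (nhds (c * 0)) :=
          (continuous_const.mul continuous_id).tendsto 0
        rw [mul_zero] at this
        exact this.mono_left nhdsWithin_le_nhds
      refine ge_of_tendsto h6 ?_
      filter_upwards [Ioc_mem_nhdsGT (zero_lt_one (α := ℝ))] with t ht using h1 t ht
    exact (sub_eq_zero.1 (norm_le_zero_iff.1 h5)).symm
  · obtain ⟨C, hC⟩ := banach_steinhaus (g := fun t : Set.Ioc (0 : ℝ) 1 => (t : ℝ)⁻¹ • D t) (by
      intro x
      obtain ⟨-, c, hc⟩ := hDW _ (hsub x)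
      refine ⟨‖P x‖ + |c|, fun t => ?_⟩
      have ht : (0 : ℝ) < t := t.2.1
      have h1 : ‖D t x‖ ≤ (‖P x‖ + |c|) * t := by
        rw [hdec]
        refine (norm_add_le _ _).trans ?_
        rw [norm_smul, Real.norm_of_nonneg ht.le, add_mul, mul_comm (t : ℝ)]
        refine add_le_add le_rfl ((hc t t.2).trans ?_)
        calc c * (t : ℝ) ^ 2 ≤ |c| * (t : ℝ) ^ 2 := by gcongr; exact le_abs_self c
          _ ≤ |c| * t := by
            gcongr
            rw [pow_two]
            exact mul_le_of_le_one_left ht.le t.2.2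
      rw [smul_apply, norm_smul, norm_inv, Real.norm_of_nonneg ht.le]
      exact (inv_mul_le_iff₀ ht).2 (by rwa [mul_comm]))
    refine ⟨max 1 C, le_max_left _ _, fun t ht => ?_⟩
    have h1 := hC ⟨t, ht⟩
    rw [norm_smul, norm_inv, Real.norm_of_nonneg ht.1.le, inv_mul_le_iff₀ ht.1] at h1
    rw [mul_comm]
    exact h1.trans (mul_le_mul_of_nonneg_left (le_max_right _ _) ht.1.le)

namespace LieCoord

open Filter Topology

variable {n : ℕ} {N : Type u} [Group N] [TopologicalSpace N]
  [ChartedSpace (EuclideanSpace ℝ (Fin n)) N] {ι : Type*}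

/-- Because f fixes the identity, the chart at the identity also serves in the target. -/
theorem mfderiv_one_apply_hom {f : N →* N} (hf : MDifferentiableAt (𝓡 n) (𝓡 n) f 1)
    (X : EuclideanSpace ℝ (Fin n)) :
    (mfderiv (𝓡 n) (𝓡 n) f 1 : EuclideanSpace ℝ (Fin n) →L[ℝ] EuclideanSpace ℝ (Fin n)) X =
      fderiv ℝ (fun u => coord n (f (pt n N u))) 0 X := by
  have h1 := hf.mfderiv
  have e : writtenInExtChartAt (𝓡 n) (𝓡 n) 1 f =
      fun y => extChartAt (𝓡 n) (1 : N) (f ((extChartAt (𝓡 n) (1 : N)).symm y)) := by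
    rw [writtenInExtChartAt, map_one]
    rfl
  have h2 : fderivWithin ℝ (writtenInExtChartAt (𝓡 n) (𝓡 n) 1 f) (Set.range (𝓡 n))
      (extChartAt (𝓡 n) (1 : N) 1) =
        fderiv ℝ (fun y => extChartAt (𝓡 n) (1 : N) (f ((extChartAt (𝓡 n) (1 : N)).symm y)))
        (extChartAt (𝓡 n) (1 : N) 1) := by
    rw [e, ModelWithCorners.range_eq_univ, fderivWithin_univ]
  have h3 : fderiv ℝ (fun u => coord n (f (pt n N u))) 0 =
      fderiv ℝ (fun y => extChartAt (𝓡 n) (1 : N) (f ((extChartAt (𝓡 n) (1 : N)).symm y)))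
        (0 + extChartAt (𝓡 n) (1 : N) 1) := by
    have h4 := fderiv_comp_add_right (𝕜 := ℝ) (x := 0)
      (f := fun y => extChartAt (𝓡 n) (1 : N) (f ((extChartAt (𝓡 n) (1 : N)).symm y)))
      (extChartAt (𝓡 n) (1 : N) 1)
    rw [← h4]
    exact fderiv_sub_const _
  rw [h3, zero_add]
  exact DFunLike.congr_fun (h1.trans h2) X

variable [LieGroup (𝓡 n) ∞ N]

theorem contDiffAt_hom {f : N →* N} (hf : ContMDiff (𝓡 n) (𝓡 n) ∞ f) :
    ContDiffAt ℝ ∞ (fun u => coord n (f (pt n N u))) 0 := by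
  refine contDiffAt_coord_comp (f := fun u => f (pt n N u)) ?_ (by simp)
  exact ContMDiffAt.comp (0 : EuclideanSpace ℝ (Fin n)) hf.contMDiffAt contMDiffAt_pt

end LieCoord

namespace LieCoord

open Filter Topology

variable {n : ℕ} {N : Type u} [Group N] [TopologicalSpace N]
  [ChartedSpace (EuclideanSpace ℝ (Fin n)) N]

/-- Along a curve differentiable at 0, the quadratic error is O(s²), so χ and P ∘ coord have the
same velocity. -/
theorem hasDerivAt_hom_of_quadratic {P : EuclideanSpace ℝ (Fin n) →L[ℝ] EuclideanSpace ℝ (Fin n)}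
    {χ : N → EuclideanSpace ℝ (Fin n)} (h1 : χ 1 = 0) {C : ℝ}
    (hC : ∀ᶠ x in 𝓝 1, ‖χ x - P (coord n x)‖ ≤ C * ‖coord n x‖ ^ 2) {c : ℝ → N}
    (hc : Tendsto c (𝓝 0) (𝓝 1)) (hc0 : c 0 = 1) {v : EuclideanSpace ℝ (Fin n)}
    (hv : HasDerivAt (fun s => coord n (c s)) v 0) :
    HasDerivAt (fun s => χ (c s)) (P v) 0 := by
  have h2 : HasDerivAt (fun s => P (coord n (c s))) (P v) 0 :=
    P.hasFDerivAt.comp_hasDerivAt (0 : ℝ) hv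
  have h3 : HasDerivAt (fun s => χ (c s) - P (coord n (c s))) 0 0 := by
    rw [hasDerivAt_iff_isLittleO]
    simp only [hc0, h1, coord_one, map_zero, sub_zero, smul_zero]
    have h4 : (fun s => coord n (c s)) =O[𝓝 0] fun s : ℝ => s := by
      simpa [hc0] using hv.isBigO_sub
    have h5 : (fun s => χ (c s) - P (coord n (c s))) =O[𝓝 0] fun s : ℝ => s ^ 2 := by
      refine (Asymptotics.IsBigO.of_bound C ?_).trans (h4.norm_left.pow 2)
      filter_upwards [hc.eventually hC] with s hs
      rwa [norm_pow, norm_norm]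
    exact h5.trans_isLittleO (Asymptotics.isLittleO_pow_id one_lt_two)
  have h6 := h3.add h2
  rw [zero_add] at h6
  exact h6.congr_of_eventuallyEq (Eventually.of_forall fun s => (sub_add_cancel _ _).symm)

variable [LieGroup (𝓡 n) ∞ N] [IsTopologicalGroup N]

/-- A stratified group has a homomorphism to its Lie algebra that is tangent at the identity to a
projection onto the first layer. -/
theorem exists_hom_firstLayer {V : ℕ → Submodule ℝ (GroupLieAlgebra (𝓡 n) N)}
    (hV : IsStratification n N V) {ζ : ℝ → N →* N}
    (hζ : ∀ t, IsStratifiedDilation n N V t (ζ t)) (hζζ : ∀ s t x, ζ s (ζ t x) = ζ (s * t) x)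
    (hζ0 : ∀ x, Tendsto (fun t => ζ t x) (𝓝 0) (𝓝 1)) :
    ∃ (P : EuclideanSpace ℝ (Fin n) →L[ℝ] EuclideanSpace ℝ (Fin n))
      (χ : N → EuclideanSpace ℝ (Fin n)), (∀ x y, χ (x * y) = χ x + χ y) ∧ Continuous χ ∧
      (∃ C : ℝ, ∀ᶠ x in 𝓝 1, ‖χ x - P (coord n x)‖ ≤ C * ‖coord n x‖ ^ 2) ∧
      (∀ x : EuclideanSpace ℝ (Fin n), x ∈ V 1 → P x = x) ∧
      ∀ x, (∀ t, fderiv ℝ (fun u => coord n (ζ t (pt n N u))) 0 x = t • x) → P x = x := by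
  set D : ℝ → EuclideanSpace ℝ (Fin n) →L[ℝ] EuclideanSpace ℝ (Fin n) :=
    fun t => fderiv ℝ (fun u => coord n (ζ t (pt n N u))) 0 with hD
  let V' : ℕ → Submodule ℝ (EuclideanSpace ℝ (Fin n)) := V
  have hDV : ∀ t k, ∀ x ∈ V' k, D t x = t ^ k • x := fun t k x hx =>
    (mfderiv_one_apply_hom ((hζ t).1.contMDiffAt.mdifferentiableAt (by simp)) x).symm.trans
      ((hζ t).2 k x hx)
  obtain ⟨P, hP1, -, hPD, hPe, C, hC1, hC⟩ := exists_projection_of_dilations (V := V')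
    hV.zero hV.isInternal.submodule_iSupIndep hV.isInternal.submodule_iSup_eq_top hDV
  -- Near 1 the dilation ζ l contracts coordinates by m = 2Cl: one Cl bounds its linear part, the
  -- other absorbs the Taylor error. This l gives m² = l/2 < l.
  set l : ℝ := 1 / (8 * C ^ 2) with hl
  have hC0 : 0 < C := by linarith
  have hl0 : 0 < l := by positivity
  have hl1 : l < 1 := by
    rw [hl, div_lt_one (by positivity)]
    nlinarith
  have hm : 2 * C * l = 1 / (4 * C) := by
    rw [hl]
    field_simp
    norm_num
  have hm1 : 2 * C * l ≤ 1 := by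
    rw [hm, div_le_one (by positivity)]
    linarith
  have hml : (2 * C * l) ^ 2 < l := by
    have : (2 * C * l) ^ 2 = l / 2 := by
      rw [hl]
      field_simp
      norm_num
    rw [this]
    linarith
  obtain ⟨C₁, hC₁0, hC₁⟩ := (contDiffAt_hom (hζ l).1).exists_norm_sub_fderiv_le
  obtain ⟨C₂, hC₂0, hC₂⟩ := exists_norm_coord_mul_sub_le (n := n) (N := N)
  have hpt : Tendsto (pt n N) (𝓝 0) (𝓝 1) := tendsto_pt
  have hC₂' : ∀ᶠ p : EuclideanSpace ℝ (Fin n) × EuclideanSpace ℝ (Fin n) in 𝓝 0 ×ˢ 𝓝 0,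
      ‖coord n (pt n N p.1 * pt n N p.2) - coord n (pt n N p.1) - coord n (pt n N p.2)‖ ≤
        C₂ * (‖coord n (pt n N p.1)‖ + ‖coord n (pt n N p.2)‖) ^ 2 :=
    ((hpt.comp tendsto_fst).prodMk_nhds (hpt.comp tendsto_snd)).eventually hC₂
  have hζt : Tendsto (fun u => ζ l (pt n N u)) (𝓝 0) (𝓝 1) := by
    have h1 : Tendsto (ζ l) (𝓝 1) (𝓝 1) := by
      simpa using (hζ l).1.continuous.tendsto 1
    exact h1.comp hpt
  have hsmall : ∀ᶠ u : EuclideanSpace ℝ (Fin n) in 𝓝 0, C₁ * ‖u‖ ≤ C * l := by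
    have h1 : Tendsto (fun u : EuclideanSpace ℝ (Fin n) => C₁ * ‖u‖) (𝓝 0) (𝓝 0) := by
      have : Continuous fun u : EuclideanSpace ℝ (Fin n) => C₁ * ‖u‖ := by fun_prop
      simpa using this.tendsto 0
    exact h1.eventually (ge_mem_nhds (by positivity))
  obtain ⟨Q, hQ, hQQ⟩ := mem_prod_self_iff.1 hC₂'
  obtain ⟨ε, hε, hball⟩ := Metric.eventually_nhds_iff_ball.1
    ((hC₁.and hsmall).and ((hζt.eventually (eventually_pt_coord (n := n))).and hQ))
  set S : Set N := {x | coord n x ∈ Metric.ball 0 ε ∧ pt n N (coord n x) = x} with hS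
  have hS1 : S ∈ 𝓝 (1 : N) :=
    (tendsto_coord.eventually (Metric.ball_mem_nhds 0 hε)).and eventually_pt_coord
  have hTaylor : ∀ x ∈ S, ‖coord n (ζ l x) - D l (coord n x)‖ ≤ C₁ * ‖coord n x‖ ^ 2 := by
    intro x hx
    have h1 := (hball _ hx.1).1.1
    simpa [hx.2] using h1
  have hcontr : ∀ x ∈ S, ‖coord n (ζ l x)‖ ≤ 2 * C * l * ‖coord n x‖ := by
    intro x hx
    have h1 := (hball _ hx.1).1.2
    calc ‖coord n (ζ l x)‖ ≤ ‖coord n (ζ l x) - D l (coord n x)‖ + ‖D l (coord n x)‖ :=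
          norm_le_norm_sub_add _ _
      _ ≤ C₁ * ‖coord n x‖ ^ 2 + C * l * ‖coord n x‖ :=
          add_le_add (hTaylor x hx) ((D l).le_of_opNorm_le (hC l ⟨hl0, hl1.le⟩) _)
      _ = (C₁ * ‖coord n x‖ + C * l) * ‖coord n x‖ := by ring
      _ ≤ (C * l + C * l) * ‖coord n x‖ := by gcongr
      _ = _ := by ring
  -- The case k = 0 is set apart because ζ 1 = id is not among the hypotheses; only large k matter.
  have hiter : ∀ (x : N) (k : ℕ), (ζ l)^[k] x = ζ (l ^ k) x ∨ k = 0 := by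
    intro x k
    induction k with
    | zero => exact Or.inr rfl
    | succ k ih =>
      left
      rw [Function.iterate_succ_apply']
      rcases ih with ih | rfl
      · rw [ih, hζζ, pow_succ']
      · simp
  obtain ⟨χ, hχ, hχc, C', hC'⟩ := exists_hom_of_quadratic_error (ζ l)
    (fun x => P (coord n x)) (fun x => ‖coord n x‖) hS1 (l := l) (m := 2 * C * l)
    (C := ‖P‖ * (C₁ + C₂)) hl0 (by positivity) hml (by positivity)
    (fun x hx => by
      refine ⟨?_, ?_⟩
      · rw [mem_ball_zero_iff]
        refine (hcontr x hx).trans_lt ?_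
        have h1 := hx.1
        rw [mem_ball_zero_iff] at h1
        exact (mul_le_of_le_one_left (norm_nonneg _) hm1).trans_lt h1
      · have h1 := (hball _ hx.1).2.1
        rwa [hx.2] at h1)
    (fun x => by
      refine ((hζ0 x).comp (tendsto_pow_atTop_nhds_zero_of_lt_one hl0.le hl1)).congr' ?_
      filter_upwards [eventually_gt_atTop 0] with k hk
      exact ((hiter x k).resolve_right hk.ne').symm)
    (fun x => norm_nonneg _) hcontr
    (fun x hx => by
      rw [← hPD, ← map_sub]
      refine (P.le_opNorm _).trans ?_
      rw [mul_assoc]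
      refine mul_le_mul_of_nonneg_left ((hTaylor x hx).trans ?_) (norm_nonneg _)
      gcongr
      linarith)
    (fun x hx y hy => by
      rw [← map_sub, ← map_sub]
      refine (P.le_opNorm _).trans ?_
      rw [mul_assoc]
      have h1 := hQQ (Set.mk_mem_prod (hball _ hx.1).2.2 (hball _ hy.1).2.2)
      simp only [Set.mem_ofPred_eq, hx.2, hy.2] at h1
      refine mul_le_mul_of_nonneg_left (h1.trans ?_) (norm_nonneg _)
      gcongr
      linarith)
    (by
      simpa [Function.comp_def] using (P.continuous.tendsto 0).comp
        (tendsto_coord (n := n) (N := N)))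
    (by simpa using (tendsto_coord (n := n) (N := N)).norm)
  exact ⟨P, χ, hχ, hχc, ⟨C', by filter_upwards [hS1] with x hx using hC' x hx⟩, hP1, hPe⟩

/-- If the one-parameter subgroups `γ i`, homogeneous for the dilations, generate a dense subgroup,
then their directions span the first layer. -/
theorem mem_span_of_mem_firstLayer {ι : Type*} {γ : ι → ℝ → N} (hγ : ∀ i, Continuous (γ i))
    (hadd : ∀ i s t, γ i (s + t) = γ i s * γ i t) {X : ι → EuclideanSpace ℝ (Fin n)}
    (hX : ∀ i, HasDerivAt (fun s => coord n (γ i s)) (X i) 0)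
    {V : ℕ → Submodule ℝ (GroupLieAlgebra (𝓡 n) N)}
    (hV : IsStratification n N V) {ζ : ℝ → N →* N}
    (hζ : ∀ t, IsStratifiedDilation n N V t (ζ t)) (hζζ : ∀ s t x, ζ s (ζ t x) = ζ (s * t) x)
    (hζ0 : ∀ x, Tendsto (fun t => ζ t x) (𝓝 0) (𝓝 1))
    (hζγ : ∀ t i s, ζ t (γ i s) = γ i (t * s))
    (hdense : Dense (Subgroup.closure {x | ∃ i s, x = γ i s} : Set N))
    {v : EuclideanSpace ℝ (Fin n)} (hv : v ∈ V 1) : v ∈ Submodule.span ℝ (Set.range X) := by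
  obtain ⟨P, χ, hχ, hχc, ⟨C, hC⟩, hP1, hPe⟩ := exists_hom_firstLayer hV hζ hζζ hζ0
  have hχ1 : χ 1 = 0 := by simpa using hχ 1 1
  set U := Submodule.span ℝ (Set.range X) with hU
  have hUc : IsClosed (U : Set (EuclideanSpace ℝ (Fin n))) := U.closed_of_finiteDimensional
  have hγt : ∀ i, Tendsto (γ i) (𝓝 0) (𝓝 1) := fun i =>
    map_zero_of_map_add (hadd i) ▸ (hγ i).tendsto 0
  -- Differentiating ζ t (γ i s) = γ i (t s) at s = 0 shows that X i is scaled by t under every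
  -- dilation.
  have hPX : ∀ i, P (X i) = X i := by
    intro i
    refine hPe _ fun t => ?_
    have h1 : HasDerivAt (fun s => coord n (ζ t (pt n N (coord n (γ i s)))))
        (fderiv ℝ (fun u => coord n (ζ t (pt n N u))) 0 (X i)) 0 := by
      have h2 : HasFDerivAt (fun u => coord n (ζ t (pt n N u)))
          (fderiv ℝ (fun u => coord n (ζ t (pt n N u))) 0) (coord n (γ i 0)) := by
        rw [map_zero_of_map_add (hadd i), coord_one]
        exact ((contDiffAt_hom (hζ t).1).differentiableAt (by simp)).hasFDerivAt
      exact h2.comp_hasDerivAt (0 : ℝ) (hX i)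
    have h3 : HasDerivAt (fun s => coord n (γ i (t * s))) (t • X i) 0 := by
      have h4 : HasDerivAt (fun s : ℝ => t * s) t 0 := by
        simpa using (hasDerivAt_id (0 : ℝ)).const_mul t
      have h5 : HasDerivAt (fun s => coord n (γ i s)) (X i) (t * 0) := by
        rw [mul_zero]
        exact hX i
      exact HasDerivAt.scomp (0 : ℝ) h5 h4
    refine h1.unique (h3.congr_of_eventuallyEq ?_)
    filter_upwards [(hγt i).eventually (eventually_pt_coord (n := n))] with s hs
    rw [hs, hζγ]
  have hχγ : ∀ i s, χ (γ i s) ∈ U := by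
    intro i s
    let φ : ℝ →+ EuclideanSpace ℝ (Fin n) :=
      AddMonoidHom.mk' (fun s => χ (γ i s)) fun s t => by rw [hadd, hχ]
    have hφ : ∀ s, χ (γ i s) = s • χ (γ i 1) := by
      intro s
      have := map_real_smul φ (hχc.comp (hγ i)) s 1
      rwa [smul_eq_mul, mul_one] at this
    have h1 := hasDerivAt_hom_of_quadratic hχ1 hC (hγt i) (map_zero_of_map_add (hadd i)) (hX i)
    have h2 : HasDerivAt (fun s => χ (γ i s)) (χ (γ i 1)) 0 := by
      have h3 : (fun s => χ (γ i s)) = fun s => s • χ (γ i 1) := funext hφ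
      rw [h3]
      simpa using (hasDerivAt_id (0 : ℝ)).smul_const (χ (γ i 1))
    rw [hφ, h2.unique h1, hPX]
    exact U.smul_mem _ (Submodule.subset_span ⟨i, rfl⟩)
  let K : Subgroup N :=
    { carrier := {x | χ x ∈ U}
      one_mem' := by
        change χ 1 ∈ U
        rw [hχ1]
        exact U.zero_mem
      mul_mem' := fun {x y} hx hy => by
        change χ (x * y) ∈ U
        rw [hχ]
        exact U.add_mem hx hy
      inv_mem' := fun {x} hx => by
        change χ x⁻¹ ∈ U
        have h := hχ x⁻¹ x
        rw [inv_mul_cancel, hχ1] at h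
        rw [eq_neg_of_add_eq_zero_left h.symm]
        exact U.neg_mem hx }
  -- χ⁻¹(U) is a closed subgroup containing the dense one generated by the γ i.
  have hK : ∀ x, χ x ∈ U := by
    have h1 : (Subgroup.closure {x | ∃ i s, x = γ i s} : Set N) ⊆ {x | χ x ∈ U} := by
      have h2 : Subgroup.closure {x | ∃ i s, x = γ i s} ≤ K :=
        (Subgroup.closure_le K).2 (by rintro _ ⟨i, s, rfl⟩; exact hχγ i s)
      exact h2
    intro x
    exact closure_minimal h1 (hUc.preimage hχc) (hdense x)
  have hc : Continuous fun s : ℝ => s • v := continuous_id.smul continuous_const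
  have hct : Tendsto (fun s : ℝ => s • v) (𝓝 0) (𝓝 0) := by simpa using hc.tendsto 0
  have hd : HasDerivAt (fun s : ℝ => coord n (pt n N (s • v))) v 0 := by
    have h1 : HasDerivAt (fun s : ℝ => s • v) v 0 := by
      simpa using (hasDerivAt_id (0 : ℝ)).smul_const v
    exact h1.congr_of_eventuallyEq (hct.eventually eventually_coord_pt)
  have h1 := hasDerivAt_hom_of_quadratic hχ1 hC (c := fun s : ℝ => pt n N (s • v))
    (tendsto_pt.comp hct) (by simp) hd
  rw [hP1 v hv] at h1
  refine hUc.mem_of_tendsto (hasDerivAt_iff_tendsto_slope.1 h1) (Eventually.of_forall fun s => ?_)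
  rw [slope_def_module]
  exact U.smul_mem _ (U.sub_mem (hK _) (hK _))

end LieCoord

/-! ### Transport to the scalable group and conclusion -/

open Filter Topology in
/-- In a group with a Carnot structure, generated by the lines through finitely many points of the
first layer, Haar-null sets are null along the translates of some product of these lines. -/
theorem ScalableStructure.exists_volume_wordProduct_eq_zero {H : Type u} [Group H]
    [TopologicalSpace H] [IsTopologicalGroup H] [SecondCountableTopology H] [MeasurableSpace H]
    [BorelSpace H] (S : ScalableStructure H) (hC : S.HasCarnotStructure) {ι : Type*} (a : ι → H)
    (ha : ∀ i, a i ∈ S.firstLayer) (hgen : S.Generates (Set.range a)) (μ : Measure H)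
    [μ.IsHaarMeasure] [SFinite μ] :
    ∃ (K : ℕ) (w : Fin K → ι), ∀ s : Set H, MeasurableSet s → μ s = 0 →
      volume {t | wordProduct (fun i r => S.dil r (a i)) K w t ∈ s} = 0 := by
  obtain ⟨n, N, _, _, _, _, _, V, ζ, e, hV, hζ, he⟩ := hC
  have : IsTopologicalGroup N := topologicalGroup_of_lieGroup (𝓡 n) ∞
  have : SecondCountableTopology N := e.toHomeomorph.secondCountableTopology
  let : MeasurableSpace N := borel N
  have : BorelSpace N := ⟨rfl⟩
  set γ : ι → ℝ → N := fun i s => e.symm (S.dil s (a i)) with hγdef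
  have heγ : ∀ i s, e (γ i s) = S.dil s (a i) := fun i s => e.apply_symm_apply _
  have hγ : ∀ i, Continuous (γ i) := fun i => e.symm.continuous.comp (S.continuous_dil_left (a i))
  have hadd : ∀ i s t, γ i (s + t) = γ i s * γ i t := fun i s t => by
    simp only [hγdef, ha i s t, _root_.map_mul]
  choose X hX using fun i => LieCoord.exists_hasDerivAt_coord (n := n) (hγ i) (hadd i)
  have hζζ : ∀ s t x, ζ s (ζ t x) = ζ (s * t) x := fun s t x => e.injective (by
    rw [he, he, he, S.dil_dil])
  have hζγ : ∀ t i s, ζ t (γ i s) = γ i (t * s) := fun t i s => e.injective (by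
    rw [he, heγ, heγ, S.dil_dil])
  have hζ0 : ∀ x, Tendsto (fun t => ζ t x) (𝓝 0) (𝓝 1) := by
    intro x
    have h1 : Tendsto (fun t => e.symm (S.dil t (e x))) (𝓝 0) (𝓝 1) := by
      have h2 : Continuous fun t => e.symm (S.dil t (e x)) :=
        e.symm.continuous.comp (S.continuous_dil_left (e x))
      simpa [S.dil_zero] using h2.tendsto 0
    refine h1.congr fun t => ?_
    rw [← he, e.symm_apply_apply]
  have hdense : Dense (Subgroup.closure {x | ∃ i s, x = γ i s} : Set N) := by
    have h1 : Dense (Subgroup.closure {x : H | ∃ b ∈ Set.range a, ∃ t : ℝ, x = S.dil t b} : Set H) :=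
      dense_iff_closure_eq.2 hgen
    have h2 := e.symm.surjective.denseRange.dense_image e.symm.continuous h1
    refine h2.mono ?_
    rintro _ ⟨x, hx, rfl⟩
    have h3 : Subgroup.closure {x : H | ∃ b ∈ Set.range a, ∃ t : ℝ, x = S.dil t b} ≤
        (Subgroup.closure {x | ∃ i s, x = γ i s}).comap (e.symm : H →* N) := by
      refine (Subgroup.closure_le _).2 ?_
      rintro _ ⟨_, ⟨i, rfl⟩, t, rfl⟩
      exact Subgroup.subset_closure ⟨i, t, rfl⟩
    exact h3 hx
  obtain ⟨K, w, t₀, hreg⟩ := LieCoord.exists_surjective_wordDeriv hadd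
    (LieCoord.eq_top_of_stratification hγ hadd hX hV fun v hv =>
      LieCoord.mem_span_of_mem_firstLayer hγ hadd hX hV hζ hζζ hζ0 hζγ hdense hv)
  refine ⟨K, w, fun s hs h0 => ?_⟩
  have : (μ.map e.symm).IsHaarMeasure := e.symm.isHaarMeasure_map μ
  have hm : MeasurableSet (e ⁻¹' s) := e.continuous.measurable hs
  have h1 : μ.map e.symm (e ⁻¹' s) = 0 := by
    have hme : Measurable (e.symm : H → N) := e.symm.continuous.measurable
    rw [Measure.map_apply hme hm, ← Set.preimage_comp]
    simpa [Function.comp_def] using h0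
  have h2 := LieCoord.volume_preimage_wordProduct_eq_zero (μ.map e.symm) hγ hadd hX hreg hm h1
  have h3 : ∀ t, e (wordProduct γ K w t) = wordProduct (fun i r => S.dil r (a i)) K w t := by
    intro t
    have := map_wordProduct (e : N →* H) γ K w t
    refine this.trans ?_
    congr 1
    funext i r
    exact heγ i r
  simpa only [Set.mem_preimage, h3] using h2

theorem ScalableStructure.HasCarnotStructure.locallyCompactSpace {H : Type u} [Group H]
    [TopologicalSpace H] {S : ScalableStructure H} (hC : S.HasCarnotStructure) :
    LocallyCompactSpace H := by
  obtain ⟨n, N, _, _, _, _, _, V, ζ, e, -⟩ := hC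
  have : LocallyCompactSpace N := Manifold.locallyCompact_of_finiteDimensional (𝓡 n)
  exact e.symm.toHomeomorph.isClosedEmbedding.locallyCompactSpace

theorem proposition3p10 {G : Type u} [Group G] [MetricSpace G] [IsTopologicalGroup G]
    [MeasurableSpace G] [BorelSpace G] (S : MetricScalableStructure G)
    (H : Subgroup G) (hH : S.IsScalableSubgroup H)
    (hCarnot : (S.restrict H hH).HasCarnotStructure)
    (m : ℕ) (a : Fin m → G) (haV : ∀ i, a i ∈ S.firstLayer) (haH : ∀ i, a i ∈ H)
    (hgen : (S.restrict H hH).Generates (Set.range fun i : Fin m => (⟨a i, haH i⟩ : H)))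
    (volH : Measure H) [volH.IsHaarMeasure] (A : Set G) (hA : MeasurableSet A) :
    (∀ g : G, volH {h : H | (h : G) ∈ g • A} = 0) ↔ A ∈ S.exceptionalClass a := by
  -- G itself need not be separable. H is locally compact, hence σ-compact by dilating a compact
  -- neighbourhood, hence second countable as a metric space; Fubini is applied only with H as
  -- factor.
  have := hCarnot.locallyCompactSpace
  have := (S.restrict H hH).sigmaCompactSpace
  have : SecondCountableTopology H := EMetric.secondCountable_of_sigmaCompact H
  have hmeas : ∀ (g : G) {B : Set G}, MeasurableSet B → MeasurableSet {h : H | (h : G) ∈ g • B} :=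
    fun g B hB => continuous_subtype_val.measurable (hB.const_smul g)
  constructor
  · intro h
    obtain ⟨K, w, hKw⟩ := (S.restrict H hH).exists_volume_wordProduct_eq_zero hCarnot
      (fun i => (⟨a i, haH i⟩ : H)) (fun i s t => Subtype.ext (haV i s t)) hgen volH
    refine S.mem_exceptionalClass_of_volume_wordProduct haV K w A hA fun g => ?_
    -- The word product w(t) lies in H, and g w(t) ∈ A exactly when w(t) ∈ g⁻¹A. This is where
    -- nullity of H ∩ gA for all g in G, not only in H, is needed.
    have h1 := hKw _ (hmeas g⁻¹ hA) (h g⁻¹)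
    have h2 : ∀ t, ((wordProduct (fun (i : Fin m) r => (S.restrict H hH).dil r ⟨a i, haH i⟩) K w t : H)
        : G) = wordProduct (fun i s => S.dil s (a i)) K w t :=
      fun t => map_wordProduct H.subtype _ K w t
    simpa only [Set.mem_ofPred_eq, h2, Set.mem_inv_smul_set_iff, smul_eq_mul] using h1
  · rintro ⟨-, B, rfl, hB⟩ g
    have h1 : {h : H | (h : G) ∈ g • ⋃ i, B i} = ⋃ i, {h : H | (h : G) ∈ g • B i} := by
      ext h
      simp [Set.smul_set_iUnion]
    rw [h1, measure_iUnion_null_iff]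
    intro i
    refine (S.restrict H hH).haar_eq_zero_of_volume_line ⟨a i, haH i⟩ volH (hmeas g (hB i).1)
      fun h => ?_
    have h2 := (hB i).2 (g⁻¹ * h)
    simp only [mul_assoc] at h2
    simp only [Set.mem_ofPred_eq, Set.mem_smul_set_iff_inv_smul_mem, smul_eq_mul, Subgroup.coe_mul]
    exact h2
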